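/- In the general externalities model there are $n$ agents $[n]$, a set of $m$ items, and for all agents $j,i$ a valuation $V_{j,i}$: $V_{j,i}(S)$ is the utility (of arbitrary sign) that agent $i$ receives when the set $S$ of items is allocated to agent $j$, and $V_{j,i}(S)=\sum_{b\in S}V_{j,i}(\{b\})$. Let $P=\langle P_1,\dots,P_n\rangle$ be a partition of the items into $n$ (possibly empty) bundles. An allocation of $P$ is a bijection $\mathcal A$ from the bundles to the agents, bundle $P_k$ going to agent $\mathcal A_k$; the utility of agent $i$ for it is $U_i(\mathcal A)=\sum_{k}V_{\mathcal A_k,i}(P_k)$, and $\mathcal A$ is a worst allocation of $P$ regarding agent $i$ if it minimizes $U_i$ among all $n!$ allocations of $P$. There is an algorithm that, given $n$, $m$, rational values $V_{j,i'}(\{b\})$ (for all agents $j,i'$ and all items $b$), a partition $P$ and an agent $i$, computes a worst allocation of $P$ regarding agent $i$ in time polynomial in the size of the input. Here the algorithm is a single program for a random-access machine with integer cells and logarithmic (bit) cost, the values are given as pairs of numerator and denominator in binary, $P$ is given by the list of the characteristic vectors of its $n$ bundles, each closed by an end marker, and the size is the total bit length of the input. -/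

import Mathlib

/-! ### Machine model: random-access programs with integer cells and logarithmic (bit) cost -/

namespace RAM

/-- Length of an integer written in binary, the sign (or a separator) included. -/
def bits (z : ℤ) : ℕ := Nat.size z.natAbs + 1

/-- A memory state: integer registers, and integer arrays (random access). -/
@[ext]
structure State where
  /-- contents of register `x` -/
  reg : ℕ → ℤ
  /-- contents of cell `z` of array `a` -/
  arr : ℕ → ℤ → ℤ

/-- Write `v` into register `x`. -/
def State.setReg (s : State) (x : ℕ) (v : ℤ) : State :=
  { s with reg := Function.update s.reg x v }

/-- Write `v` into cell `z` of array `a`. -/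
def State.setArr (s : State) (a : ℕ) (z v : ℤ) : State :=
  { s with arr := Function.update s.arr a (Function.update (s.arr a) z v) }

/-- Integer expressions. The names of registers and arrays are fixed by the program text;
`get a e` is indirect addressing: cell number `e` of array `a`. -/
inductive Expr where
  | const (c : ℤ)
  | reg (x : ℕ)
  | get (a : ℕ) (e : Expr)
  | add (e₁ e₂ : Expr)
  | sub (e₁ e₂ : Expr)
  | mul (e₁ e₂ : Expr)

/-- Value of an expression. -/
def Expr.eval (s : State) : Expr → ℤ
  | .const c => c
  | .reg x => s.reg x
  | .get a e => s.arr a (e.eval s)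
  | .add e₁ e₂ => e₁.eval s + e₂.eval s
  | .sub e₁ e₂ => e₁.eval s - e₂.eval s
  | .mul e₁ e₂ => e₁.eval s * e₂.eval s

/-- Time for evaluating an expression. Reading a number costs its length, an array access also
the length of the address, an addition or subtraction the sum of the lengths of the operands, a
multiplication the product of the lengths. -/
def Expr.cost (s : State) : Expr → ℕ
  | .const c => bits c
  | .reg x => bits (s.reg x)
  | .get a e => e.cost s + bits (e.eval s) + bits (s.arr a (e.eval s))
  | .add e₁ e₂ => e₁.cost s + e₂.cost s + (bits (e₁.eval s) + bits (e₂.eval s))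
  | .sub e₁ e₂ => e₁.cost s + e₂.cost s + (bits (e₁.eval s) + bits (e₂.eval s))
  | .mul e₁ e₂ => e₁.cost s + e₂.cost s + bits (e₁.eval s) * bits (e₂.eval s)

/-- Programs. The test of a branch or a loop is whether an expression is positive. -/
inductive Prog where
  | skip
  | assign (x : ℕ) (e : Expr)
  | store (a : ℕ) (idx e : Expr)
  | seq (p q : Prog)
  | ite (c : Expr) (p q : Prog)
  | loop (c : Expr) (p : Prog)

/-- `Exec p s s' t`: program `p`, started in state `s`, halts in state `s'` after time `t`. -/
inductive Exec : Prog → State → State → ℕ → Prop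
  | skip (s : State) : Exec .skip s s 1
  | assign (x : ℕ) (e : Expr) (s : State) :
      Exec (.assign x e) s (s.setReg x (e.eval s)) (e.cost s + 1)
  | store (a : ℕ) (idx e : Expr) (s : State) :
      Exec (.store a idx e) s (s.setArr a (idx.eval s) (e.eval s)) (idx.cost s + e.cost s + 1)
  | seq {p q : Prog} {s s₁ s₂ : State} {t₁ t₂ : ℕ} :
      Exec p s s₁ t₁ → Exec q s₁ s₂ t₂ → Exec (.seq p q) s s₂ (t₁ + t₂)
  | ite_pos {c : Expr} {p q : Prog} {s s₁ : State} {t : ℕ} :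
      0 < c.eval s → Exec p s s₁ t → Exec (.ite c p q) s s₁ (c.cost s + 1 + t)
  | ite_neg {c : Expr} {p q : Prog} {s s₁ : State} {t : ℕ} :
      ¬ 0 < c.eval s → Exec q s s₁ t → Exec (.ite c p q) s s₁ (c.cost s + 1 + t)
  | loop_done {c : Expr} {p : Prog} {s : State} :
      ¬ 0 < c.eval s → Exec (.loop c p) s s (c.cost s + 1)
  | loop_step {c : Expr} {p : Prog} {s s₁ s₂ : State} {t₁ t₂ : ℕ} :
      0 < c.eval s → Exec p s s₁ t₁ → Exec (.loop c p) s₁ s₂ t₂ →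
      Exec (.loop c p) s s₂ (c.cost s + 1 + t₁ + t₂)

/-- Initial state on an input list: register 0 holds the length of the list, cells `0, 1, 2, …` of
array 0 hold its entries, and everything else is 0. -/
def initial (input : List ℤ) : State where
  reg x := if x = 0 then (input.length : ℤ) else 0
  arr a z := if a = 0 ∧ 0 ≤ z then input.getD z.toNat 0 else 0

/-- Output list of a final state: its length is in register 0, its entries are in cells
`0, 1, 2, …` of array 1. -/
def output (s : State) : List ℤ :=
  (List.range (s.reg 0).toNat).map fun k => s.arr 1 (k : ℤ)

/-- Size of an input list: the total length of its entries in binary. -/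
def inputSize (input : List ℤ) : ℕ := (input.map bits).sum

end RAM

/-! ### The general externalities model -/

namespace Externalities

/-- Valuations in the general externalities model with agents `Fin n` and items `Fin m`:
`val j i S` is the utility that agent `i` receives when the set `S` of items is allocated to
agent `j`. The only requirement is additivity. -/
structure Valuations (n m : ℕ) where
  val : Fin n → Fin n → Finset (Fin m) → ℚ
  additive : ∀ j i S, val j i S = ∑ b ∈ S, val j i {b}

/-- A partition `⟨P₁, …, Pₙ⟩` of the `m` items into `n` (possibly empty) bundles. -/
structure Partition (n m : ℕ) where
  bundle : Fin n → Finset (Fin m)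
  disjoint : ∀ k l, k ≠ l → Disjoint (bundle k) (bundle l)
  cover : ∀ b, ∃ k, b ∈ bundle k

/-- An allocation of the bundles of a partition, one to each agent: bundle `k` goes to agent
`A k`. -/
abbrev Allocation (n : ℕ) := Fin n ≃ Fin n

variable {n m : ℕ}

/-- Utility of agent `i` for the allocation `A` of the partition `P`. -/
def utility (V : Valuations n m) (P : Partition n m) (i : Fin n) (A : Allocation n) : ℚ :=
  ∑ k, V.val (A k) i (P.bundle k)

/-- `A` is a worst allocation of `P` regarding agent `i`: it minimizes the utility of `i` among
all allocations of `P`. -/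
def IsWorstAllocation (V : Valuations n m) (P : Partition n m) (i : Fin n) (A : Allocation n) :
    Prop :=
  ∀ B : Allocation n, utility V P i A ≤ utility V P i B

/-- The input as a list of integers: `n`, `m` and the number of the agent `i`; for every bundle its
characteristic vector, closed by the end marker `-1`; and numerator and denominator of the value of
every single item `b` for every agent `a`, if allocated to agent `j`, in the lexicographic order of
`(j, a, b)`. -/
def encode (V : Valuations n m) (P : Partition n m) (i : Fin n) : List ℤ :=
  [(n : ℤ), (m : ℤ), ((i : ℕ) : ℤ)]
  ++ (List.ofFn fun k : Fin n =>
      (List.ofFn fun b : Fin m => if b ∈ P.bundle k then (1 : ℤ) else 0) ++ [-1]).flatten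
  ++ (List.ofFn fun j : Fin n => (List.ofFn fun a : Fin n => (List.ofFn fun b : Fin m =>
      [(V.val j a {b}).num, ((V.val j a {b}).den : ℤ)]).flatten).flatten).flatten

/-- An allocation as a list of integers: the agents who receive bundles `0, …, n - 1`. -/
def encodeAllocation (A : Allocation n) : List ℤ :=
  List.ofFn fun k : Fin n => ((A k : ℕ) : ℤ)

end Externalities

/-! Giving bundle `k` to agent `l` contributes V_{l,i}(P_k) to the utility of `i`, whatever happens
to the other bundles. A worst allocation is therefore a minimum-cost perfect matching for the n × n
matrix of these numbers. By additivity each entry is a sum of single-item values. To stay within the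
integers, the program keeps the product D of the denominators met so far and multiplies the whole
matrix by each new one. The result is D > 0 times the true matrix and has the same minimizers
(`CostMatrix.program_spec`).

The assignment problem is solved by the Hungarian method; optimality follows from a feasible dual
solution that is tight on the chosen edges (`sum_le_of_tight`). The assignment `A` is a full
permutation throughout, and phase `k` makes row `k` tight in addition to the rows before it. From
row `k`, columns are reached through tight edges, and a reached column makes the row holding it
reached. `Search.step` adjusts the duals so that a further column becomes reachable, until the
column `A k` itself is reached. `Augment.step` then rotates `A` along the resulting cycle through
`k`. Both processes need at most n rounds and idle afterwards, so loops of fixed length suffice.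

For the running time, all loops have length n or m, and every multiplication has an input cell as
one factor. The loop lengths are at most the input size, and every executed assignment adds only a
bounded number of bits to the longest number, so no repeated squaring can occur. Hence all numbers
have polynomial length, and the program runs in polynomial time (`ForProg.exec_toProg`). -/

namespace RAM

/-! ### Bit lengths -/

lemma one_le_bits (z : ℤ) : 1 ≤ bits z := by simp [bits]

lemma bits_le_iff (z : ℤ) (k : ℕ) : bits z ≤ k + 1 ↔ z.natAbs < 2 ^ k := by
  simp [bits, Nat.size_le]

lemma bits_neg (z : ℤ) : bits (-z) = bits z := by simp [bits]

lemma bits_add_le {a b : ℤ} {k : ℕ} (ha : bits a ≤ k) (hb : bits b ≤ k) :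
    bits (a + b) ≤ k + 1 := by
  obtain ⟨k, rfl⟩ := Nat.exists_eq_add_of_le' ((one_le_bits a).trans ha)
  rw [bits_le_iff] at *
  calc (a + b).natAbs ≤ a.natAbs + b.natAbs := Int.natAbs_add_le a b
    _ < 2 ^ k + 2 ^ k := by omega
    _ = 2 ^ (k + 1) := by ring

lemma bits_sub_le {a b : ℤ} {k : ℕ} (ha : bits a ≤ k) (hb : bits b ≤ k) :
    bits (a - b) ≤ k + 1 := by
  rw [sub_eq_add_neg]
  exact bits_add_le ha (by rwa [bits_neg])

lemma bits_mul_le (a b : ℤ) : bits (a * b) ≤ bits a + bits b := by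
  have h : bits (a * b) ≤ (Nat.size a.natAbs + Nat.size b.natAbs) + 1 := by
    rw [bits_le_iff, Int.natAbs_mul, pow_add]
    exact Nat.mul_lt_mul'' (Nat.lt_size_self _) (Nat.lt_size_self _)
  simp only [bits] at *
  omega

lemma bits_natCast_le (k : ℕ) : bits (k : ℤ) ≤ k + 1 := by
  rw [bits_le_iff]
  simpa using Nat.lt_two_pow_self

/-! ### Expressions that enlarge numbers by a bounded number of bits -/

/-- The expression is a cell of the input array. -/
def Expr.isInput : Expr → Bool
  | .get 0 _ => true
  | _ => false

/-- Every multiplication in the expression has a cell of the input array as its left factor. -/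
def Expr.tame : Expr → Bool
  | .const _ => true
  | .reg _ => true
  | .get _ e => e.tame
  | .add e₁ e₂ => e₁.tame && e₂.tame
  | .sub e₁ e₂ => e₁.tame && e₂.tame
  | .mul e₁ e₂ => e₁.isInput && e₁.tame && e₂.tame

/-- Number of nodes of an expression. -/
def Expr.nodes : Expr → ℕ
  | .const _ => 1
  | .reg _ => 1
  | .get _ e => e.nodes + 1
  | .add e₁ e₂ => e₁.nodes + e₂.nodes + 1
  | .sub e₁ e₂ => e₁.nodes + e₂.nodes + 1
  | .mul e₁ e₂ => e₁.nodes + e₂.nodes + 1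

open Polynomial in
/-- Bound for the number of bits by which the value of a tame expression exceeds the cells of the
state, in terms of a bound for the input. -/
noncomputable def Expr.growth : Expr → Polynomial ℕ
  | .const c => C (bits c)
  | .reg _ => 0
  | .get _ e => e.growth
  | .add e₁ e₂ => e₁.growth + e₂.growth + 1
  | .sub e₁ e₂ => e₁.growth + e₂.growth + 1
  | .mul e₁ e₂ => e₁.growth + e₂.growth + X

/-- All cells of the state have at most `M` bits, those of the input array at most `S`, and the
cells `0` and `1` of the input array are at most `S`. -/
structure Bounded (S M : ℕ) (s : State) : Prop where
  reg : ∀ x, bits (s.reg x) ≤ M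
  arr : ∀ a z, bits (s.arr a z) ≤ M
  input : ∀ z, bits (s.arr 0 z) ≤ S
  fst : (s.arr 0 0).toNat ≤ S
  snd : (s.arr 0 1).toNat ≤ S

lemma Bounded.mono {S M M' : ℕ} {s : State} (h : Bounded S M s) (hM : M ≤ M') : Bounded S M' s :=
  ⟨fun x => (h.reg x).trans hM, fun a z => (h.arr a z).trans hM, h.input, h.fst, h.snd⟩

/-- Lengths add under multiplication, and tameness gives the left factor at most `S` bits; the
excess over `M` is thus independent of `M`. An array access does not lengthen anything, since every
cell has at most `M` bits whatever the address. -/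
lemma Expr.bits_eval_le {S M : ℕ} {s : State} (hs : Bounded S M s) (e : Expr) (he : e.tame) :
    bits (e.eval s) ≤ M + e.growth.eval S := by
  induction e with
  | const c => simp [eval, growth]
  | reg x => simpa [eval, growth] using hs.reg x
  | get a e ih => exact (hs.arr _ _).trans (Nat.le_add_right _ _)
  | add e₁ e₂ ih₁ ih₂ =>
    simp only [tame, Bool.and_eq_true] at he
    have h₁ := ih₁ he.1
    have h₂ := ih₂ he.2
    simp only [eval, growth, Polynomial.eval_add, Polynomial.eval_one]
    exact bits_add_le (k := M + (e₁.growth.eval S + e₂.growth.eval S)) (by omega) (by omega)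
  | sub e₁ e₂ ih₁ ih₂ =>
    simp only [tame, Bool.and_eq_true] at he
    have h₁ := ih₁ he.1
    have h₂ := ih₂ he.2
    simp only [eval, growth, Polynomial.eval_add, Polynomial.eval_one]
    exact bits_sub_le (k := M + (e₁.growth.eval S + e₂.growth.eval S)) (by omega) (by omega)
  | mul e₁ e₂ ih₁ ih₂ =>
    simp only [tame, Bool.and_eq_true] at he
    have h₂ := ih₂ he.2
    have h₁ : bits (e₁.eval s) ≤ S := by
      obtain ⟨⟨h, -⟩, -⟩ := he
      unfold isInput at h
      split at h
      · exact hs.input _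
      · cases h
    have := bits_mul_le (e₁.eval s) (e₂.eval s)
    simp only [eval, growth, Polynomial.eval_add, Polynomial.eval_X]
    omega

/-- All intermediate values have at most `L` bits, so one node costs at most L² (a product) or 2L (a
sum, or an address with its cell). -/
lemma Expr.cost_le {S M L : ℕ} {s : State} (hs : Bounded S M s) (e : Expr) (he : e.tame)
    (hL : M + e.growth.eval S ≤ L) : e.cost s ≤ e.nodes * (L * L + 2 * L) := by
  induction e with
  | const c =>
    simp only [growth, Polynomial.eval_C] at hL
    simp only [cost, nodes]
    nlinarith
  | reg x =>
    have := hs.reg x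
    simp only [cost, nodes]
    nlinarith
  | get a e ih =>
    have h₁ := ih he hL
    have h₂ := bits_eval_le hs e he
    have h₃ := hs.arr a (e.eval s)
    simp only [growth] at hL
    simp only [cost, nodes, add_mul, one_mul]
    nlinarith
  | add e₁ e₂ ih₁ ih₂ =>
    simp only [tame, Bool.and_eq_true] at he
    simp only [growth, Polynomial.eval_add, Polynomial.eval_one] at hL
    have h₁ := ih₁ he.1 (by omega)
    have h₂ := ih₂ he.2 (by omega)
    have h₃ := bits_eval_le hs e₁ he.1
    have h₄ := bits_eval_le hs e₂ he.2
    simp only [cost, nodes, add_mul, one_mul]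
    nlinarith
  | sub e₁ e₂ ih₁ ih₂ =>
    simp only [tame, Bool.and_eq_true] at he
    simp only [growth, Polynomial.eval_add, Polynomial.eval_one] at hL
    have h₁ := ih₁ he.1 (by omega)
    have h₂ := ih₂ he.2 (by omega)
    have h₃ := bits_eval_le hs e₁ he.1
    have h₄ := bits_eval_le hs e₂ he.2
    simp only [cost, nodes, add_mul, one_mul]
    nlinarith
  | mul e₁ e₂ ih₁ ih₂ =>
    simp only [tame, Bool.and_eq_true] at he
    simp only [growth, Polynomial.eval_add, Polynomial.eval_X] at hL
    have h₁ := ih₁ he.1.2 (by omega)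
    have h₂ := ih₂ he.2 (by omega)
    have h₃ := bits_eval_le hs e₁ he.1.2
    have h₄ := bits_eval_le hs e₂ he.2
    have h₅ : bits (e₁.eval s) * bits (e₂.eval s) ≤ L * L :=
      Nat.mul_le_mul (by omega) (by omega)
    simp only [cost, nodes, add_mul, one_mul]
    omega

/-! ### Programs with counted loops -/

/-- Programs whose only loops are counted: `upto x c p` performs `p` with register `x` running
through `0, 1, …` up to cell `c` of the input array, exclusively. -/
inductive ForProg where
  | skip
  | assign (x : ℕ) (e : Expr)
  | store (a : ℕ) (idx e : Expr)
  | seq (p q : ForProg)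
  | ite (c : Expr) (p q : ForProg)
  | upto (x c : ℕ) (p : ForProg)

namespace ForProg

/-- The test of a counted loop. -/
def guard (x c : ℕ) : Expr := .sub (.get 0 (.const c)) (.reg x)

/-- The increment of a counter. -/
def incr (x : ℕ) : Expr := .add (.reg x) (.const 1)

/-- Translation into a program of the machine. -/
def toProg : ForProg → Prog
  | skip => .skip
  | assign x e => .assign x e
  | store a i e => .store a i e
  | seq p q => .seq p.toProg q.toProg
  | ite c p q => .ite c p.toProg q.toProg
  | upto x c p => .seq (.assign x (.const 0))
      (.loop (guard x c) (.seq p.toProg (.assign x (incr x))))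

/-- Final state of a program with counted loops. -/
def run : ForProg → State → State
  | skip => id
  | assign x e => fun s => s.setReg x (e.eval s)
  | store a i e => fun s => s.setArr a (i.eval s) (e.eval s)
  | seq p q => fun s => q.run (p.run s)
  | ite c p q => fun s => if 0 < c.eval s then p.run s else q.run s
  | upto x c p => fun s =>
      (fun s => (p.run s).setReg x ((p.run s).reg x + 1))^[(s.arr 0 c).toNat] (s.setReg x 0)

/-- Register `x` occurs as a target in the program. -/
def writesReg : ForProg → ℕ → Bool
  | skip, _ => false
  | assign x _, y => x == y
  | store _ _ _, _ => false
  | seq p q, y => p.writesReg y || q.writesReg y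
  | ite _ p q, y => p.writesReg y || q.writesReg y
  | upto x _ p, y => x == y || p.writesReg y

/-- Array `a` occurs as a target in the program. -/
def writesArr : ForProg → ℕ → Bool
  | skip, _ => false
  | assign _ _, _ => false
  | store a _ _, b => a == b
  | seq p q, b => p.writesArr b || q.writesArr b
  | ite _ p q, b => p.writesArr b || q.writesArr b
  | upto _ _ p, b => p.writesArr b

/-- The program never writes into the input array or into the counter of an active loop, its
expressions are tame, and the loops are bounded by the cells `0` and `1` of the input array. -/
def valid : ForProg → Bool
  | skip => true
  | assign _ e => e.tame
  | store a i e => a != 0 && i.tame && e.tame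
  | seq p q => p.valid && q.valid
  | ite c p q => c.tame && p.valid && q.valid
  | upto x c p => (c == 0 || c == 1) && !p.writesReg x && p.valid

/-! ### Frame properties and invariants of counted loops -/

lemma run_reg (p : ForProg) {y : ℕ} (h : p.writesReg y = false) (s : State) :
    (p.run s).reg y = s.reg y := by
  induction p generalizing s with
  | skip => rfl
  | assign x e =>
    have : y ≠ x := by rintro rfl; simp [writesReg] at h
    simp [run, State.setReg, this]
  | store a i e => rfl
  | seq p q ihp ihq =>
    simp only [writesReg, Bool.or_eq_false_iff] at h
    simp only [run]
    rw [ihq h.2, ihp h.1]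
  | ite c p q ihp ihq =>
    simp only [writesReg, Bool.or_eq_false_iff] at h
    simp only [run]
    split
    · exact ihp h.1 s
    · exact ihq h.2 s
  | upto x c p ih =>
    simp only [writesReg, Bool.or_eq_false_iff, beq_eq_false_iff_ne] at h
    have key : ∀ k s, ((fun s => (p.run s).setReg x ((p.run s).reg x + 1))^[k] s).reg y
        = s.reg y := by
      intro k
      induction k with
      | zero => intro s; rfl
      | succ k ihk =>
        intro s
        rw [Function.iterate_succ_apply, ihk]
        simp [State.setReg, h.1.symm, ih h.2]
    simp only [run]
    rw [key]
    simp [State.setReg, h.1.symm]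

lemma run_arr (p : ForProg) {b : ℕ} (h : p.writesArr b = false) (s : State) :
    (p.run s).arr b = s.arr b := by
  induction p generalizing s with
  | skip => rfl
  | assign x e => rfl
  | store a i e =>
    have : b ≠ a := by rintro rfl; simp [writesArr] at h
    simp [run, State.setArr, this]
  | seq p q ihp ihq =>
    simp only [writesArr, Bool.or_eq_false_iff] at h
    simp only [run]
    rw [ihq h.2, ihp h.1]
  | ite c p q ihp ihq =>
    simp only [writesArr, Bool.or_eq_false_iff] at h
    simp only [run]
    split
    · exact ihp h.1 s
    · exact ihq h.2 s
  | upto x c p ih =>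
    have key : ∀ k s, ((fun s => (p.run s).setReg x ((p.run s).reg x + 1))^[k] s).arr b
        = s.arr b := by
      intro k
      induction k with
      | zero => intro s; rfl
      | succ k ihk =>
        intro s
        rw [Function.iterate_succ_apply, ihk]
        simp [State.setReg, ih h]
    simp only [run]
    rw [key]
    rfl

/-- Protects the loop bounds, which are cells of the input array, from being changed by the loop
body. -/
lemma writesArr_zero_of_valid (p : ForProg) (h : p.valid) : p.writesArr 0 = false := by
  induction p with
  | skip => rfl
  | assign x e => rfl
  | store a i e => simp [valid] at h; simp [writesArr, h.1.1]
  | seq p q ihp ihq => simp [valid] at h; simp [writesArr, ihp h.1, ihq h.2]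
  | ite c p q ihp ihq => simp [valid] at h; simp [writesArr, ihp h.1.2, ihq h.2]
  | upto x c p ih => simp [valid] at h; simp [writesArr, ih h.2]

/-- Invariant rule for counted loops, with the frame condition built in. -/
lemma upto_induction {x c : ℕ} {p : ForProg} {s : State} {N : ℕ} (hN : s.arr 0 c = N)
    (hx : p.writesReg x = false) (I : ℕ → State → Prop) (h0 : I 0 (s.setReg x 0))
    (hstep : ∀ i < N, ∀ s' : State, s'.reg x = i →
      (∀ y, (upto x c p).writesReg y = false → s'.reg y = s.reg y) →
      (∀ b, (upto x c p).writesArr b = false → s'.arr b = s.arr b) →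
      I i s' → I (i + 1) ((p.run s').setReg x (i + 1 : ℕ))) :
    I N ((upto x c p).run s) := by
  -- The counter value and the frame condition are carried along with `I`, so that `hstep` may use
  -- them.
  have key : ∀ i ≤ N, ∃ s', s' = (fun s => (p.run s).setReg x ((p.run s).reg x + 1))^[i]
      (s.setReg x 0) ∧ s'.reg x = i ∧
      (∀ y, (upto x c p).writesReg y = false → s'.reg y = s.reg y) ∧
      (∀ b, (upto x c p).writesArr b = false → s'.arr b = s.arr b) ∧ I i s' := by
    intro i
    induction i with
    | zero =>
      refine fun _ => ⟨_, rfl, by simp [State.setReg], fun y hy => ?_, fun b _ => rfl, h0⟩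
      simp only [writesReg, Bool.or_eq_false_iff, beq_eq_false_iff_ne] at hy
      simp [State.setReg, hy.1.symm]
    | succ i ih =>
      intro hi
      obtain ⟨s', hs', hx', hr, ha, hI⟩ := ih (by omega)
      refine ⟨(p.run s').setReg x (i + 1 : ℕ), ?_, by simp [State.setReg], fun y hy => ?_,
        fun b hb => ?_, hstep i (by omega) s' hx' hr ha hI⟩
      · rw [Function.iterate_succ_apply', ← hs', run_reg p hx, hx']
        simp
      · rw [← hr y hy]
        simp only [writesReg, Bool.or_eq_false_iff, beq_eq_false_iff_ne] at hy
        simp [State.setReg, hy.1.symm, run_reg p hy.2]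
      · rw [← ha b hb]
        simp only [writesArr] at hb
        simp [State.setReg, run_arr p hb]
  obtain ⟨s', hs', -, -, -, h⟩ := key N le_rfl
  simp only [run, hN, Int.toNat_natCast]
  rwa [← hs']

/-! ### Polynomial bounds for number lengths and running time -/

open Polynomial in
/-- Bound for the number of bits by which a program enlarges the cells. -/
noncomputable def growth : ForProg → Polynomial ℕ
  | skip => 0
  | assign _ e => e.growth
  | store _ i e => i.growth + e.growth
  | seq p q => p.growth + q.growth
  | ite c p q => c.growth + p.growth + q.growth
  | upto x c p => (Expr.const 0).growth + (guard x c).growth + X * (p.growth + (incr x).growth)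

open Polynomial in
/-- Bound for the running time of a program, given a bound for the lengths of all numbers. -/
noncomputable def time (L : Polynomial ℕ) : ForProg → Polynomial ℕ
  | skip => 1
  | assign _ e => C e.nodes * (L * L + 2 * L) + 1
  | store _ i e => C (i.nodes + e.nodes) * (L * L + 2 * L) + 1
  | seq p q => p.time L + q.time L
  | ite c p q => C c.nodes * (L * L + 2 * L) + 1 + p.time L + q.time L
  | upto x c p => C (Expr.const 0).nodes * (L * L + 2 * L) + 1
      + (X + 1) * (C ((guard x c).nodes + (incr x).nodes) * (L * L + 2 * L) + 2 + p.time L)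

lemma _root_.RAM.Bounded.setReg {S M : ℕ} {s : State} (hs : Bounded S M s) (x : ℕ) {v : ℤ}
    (hv : bits v ≤ M) : Bounded S M (s.setReg x v) := by
  refine ⟨fun y => ?_, hs.arr, hs.input, hs.fst, hs.snd⟩
  by_cases h : y = x
  · subst h; simpa [State.setReg] using hv
  · simpa [State.setReg, h] using hs.reg y

lemma _root_.RAM.Bounded.setArr {S M : ℕ} {s : State} (hs : Bounded S M s) {a : ℕ} (ha : a ≠ 0)
    (z : ℤ) {v : ℤ} (hv : bits v ≤ M) : Bounded S M (s.setArr a z v) := by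
  have h0 : (s.setArr a z v).arr 0 = s.arr 0 := by simp [State.setArr, ha.symm]
  refine ⟨hs.reg, fun b w => ?_, by rw [h0]; exact hs.input, by rw [h0]; exact hs.fst,
    by rw [h0]; exact hs.snd⟩
  by_cases h : b = a
  · subst h
    by_cases hw : w = z
    · subst hw; simpa [State.setArr] using hv
    · simpa [State.setArr, hw] using hs.arr b w
  · simpa [State.setArr, h] using hs.arr b w

/-- A valid program with counted loops halts within a time that is polynomial in the bound for
the input. -/
theorem exec_toProg (p : ForProg) (hp : p.valid) (L : Polynomial ℕ) (S M : ℕ) (s : State)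
    (hs : Bounded S M s) (hL : M + p.growth.eval S ≤ L.eval S) :
    ∃ t, Exec p.toProg s (p.run s) t ∧ t ≤ (p.time L).eval S ∧
      Bounded S (M + p.growth.eval S) (p.run s) := by
  induction p generalizing M s with
  | skip => exact ⟨1, .skip s, by simp [time], by simpa [growth, run] using hs⟩
  | assign x e =>
    have h := Expr.cost_le hs e hp hL
    refine ⟨_, .assign x e s, by simpa [time] using h, ?_⟩
    exact (hs.mono (Nat.le_add_right _ _)).setReg x (Expr.bits_eval_le hs e hp)
  | store a i e =>
    simp only [valid, Bool.and_eq_true, bne_iff_ne] at hp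
    simp only [growth, Polynomial.eval_add] at hL ⊢
    have h₁ := Expr.cost_le (L := L.eval S) hs i hp.1.2 (by omega)
    have h₂ := Expr.cost_le (L := L.eval S) hs e hp.2 (by omega)
    refine ⟨_, .store a i e s, ?_, ?_⟩
    · simp [time, add_mul] at *; omega
    · have := Expr.bits_eval_le hs e hp.2
      exact (hs.mono (Nat.le_add_right _ _)).setArr hp.1.1 _ (by omega)
  | seq p q ihp ihq =>
    simp only [valid, Bool.and_eq_true] at hp
    simp only [growth, Polynomial.eval_add] at hL ⊢
    obtain ⟨t₁, e₁, h₁, b₁⟩ := ihp hp.1 M s hs (by omega)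
    obtain ⟨t₂, e₂, h₂, b₂⟩ := ihq hp.2 _ _ b₁ (by omega)
    refine ⟨_, .seq e₁ e₂, ?_, b₂.mono (by omega)⟩
    simp only [time, Polynomial.eval_add]
    omega
  | ite c p q ihp ihq =>
    simp only [valid, Bool.and_eq_true] at hp
    simp only [growth, Polynomial.eval_add] at hL ⊢
    have h := Expr.cost_le (L := L.eval S) hs c hp.1.1 (by omega)
    by_cases hc : 0 < c.eval s
    · obtain ⟨t₁, e₁, h₁, b₁⟩ := ihp hp.1.2 M s hs (by omega)
      have hr : (ite c p q).run s = p.run s := by simp [run, hc]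
      rw [hr]
      refine ⟨c.cost s + 1 + t₁, .ite_pos hc e₁, ?_, b₁.mono (by omega)⟩
      simp [time] at *; omega
    · obtain ⟨t₁, e₁, h₁, b₁⟩ := ihq hp.2 M s hs (by omega)
      have hr : (ite c p q).run s = q.run s := by simp [run, hc]
      rw [hr]
      refine ⟨c.cost s + 1 + t₁, .ite_neg hc e₁, ?_, b₁.mono (by omega)⟩
      simp [time] at *; omega
  | upto x c p ih =>
    simp only [valid, Bool.and_eq_true, Bool.or_eq_true, beq_iff_eq, Bool.not_eq_true'] at hp
    obtain ⟨⟨hc, hx⟩, hpv⟩ := hp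
    set f : State → State := fun s => (p.run s).setReg x ((p.run s).reg x + 1) with hf
    set g := p.growth.eval S + (incr x).growth.eval S with hg
    -- `K` bounds one round: test, body and increment; the 2 pays for the unit costs of test and
    -- increment.
    obtain ⟨K, hK⟩ : ∃ K, K = (guard x c).nodes * (L.eval S * L.eval S + 2 * L.eval S)
      + (incr x).nodes * (L.eval S * L.eval S + 2 * L.eval S) + 2 + (p.time L).eval S := ⟨_, rfl⟩
    -- Induction on the number `d` of remaining rounds, each of which adds at most `g` bits. For `d
    -- = 0` only an inequality is required, since a negative loop bound also means no rounds. The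
    -- factor `d + 1` in the time includes the final failing test.
    have key : ∀ d (M : ℕ) (s : State), Bounded S M s →
        M + (guard x c).growth.eval S + d * g ≤ L.eval S →
        s.arr 0 c - s.reg x ≤ d → (0 < d → s.arr 0 c - s.reg x = d) →
        ∃ t, Exec (.loop (guard x c) (.seq p.toProg (.assign x (incr x)))) s (f^[d] s) t ∧
          t ≤ (d + 1) * K ∧ Bounded S (M + d * g) (f^[d] s) := by
      intro d
      induction d with
      | zero =>
        intro M s hs hL h0 _
        have h := Expr.cost_le (L := L.eval S) hs (guard x c) rfl (by omega)
        refine ⟨_, .loop_done ?_, ?_, by simpa using hs⟩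
        · simpa [guard, Expr.eval] using h0
        · rw [zero_add, one_mul]; omega
      | succ d ihd =>
        intro M s hs hL _ h0
        have h0 := h0 (by omega)
        have hd : (d + 1) * g = g + d * g := by ring
        have h := Expr.cost_le (L := L.eval S) hs (guard x c) rfl (by omega)
        obtain ⟨t₁, e₁, h₁, b₁⟩ := ih hpv M s hs (by omega)
        have h' := Expr.cost_le (L := L.eval S) b₁ (incr x) rfl (by omega)
        have hb := Expr.bits_eval_le b₁ (incr x) rfl
        have b₂ : Bounded S (M + g) (f s) :=
          (b₁.mono (M' := M + g) (by omega)).setReg x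
            (hb.trans (by omega))
        have h0c : (f s).arr 0 c = s.arr 0 c := by
          simp [hf, State.setReg, run_arr p (writesArr_zero_of_valid p hpv)]
        have hrx : (f s).reg x = s.reg x + 1 := by
          simp [hf, State.setReg, run_reg p hx]
        obtain ⟨t₂, e₂, h₂, b₃⟩ := ihd (M + g) (f s) b₂ (by omega)
          (by rw [h0c, hrx]; push_cast at h0; omega)
          (by intro; rw [h0c, hrx]; push_cast at h0; omega)
        refine ⟨_, .loop_step ?_ (.seq e₁ (.assign x (incr x) _)) e₂, ?_, ?_⟩
        · simp only [guard, Expr.eval]; push_cast at h0; omega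
        · have : (d + 1 + 1) * K = (d + 1) * K + K := by ring
          omega
        · exact b₃.mono (by omega)
    have hN : (s.arr 0 c).toNat ≤ S := by
      rcases hc with rfl | rfl
      · exact hs.fst
      · exact hs.snd
    have hgr : (upto x c p).growth.eval S
        = (Expr.const 0).growth.eval S + (guard x c).growth.eval S + S * g := by
      simp [growth, hg]
    have hNg : (s.arr 0 c).toNat * g ≤ S * g := Nat.mul_le_mul_right _ hN
    rw [hgr] at hL ⊢
    have h := Expr.cost_le (L := L.eval S) hs (.const 0) rfl (by omega)
    have b₀ : Bounded S (M + (Expr.const 0).growth.eval S) (s.setReg x 0) :=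
      (hs.mono (Nat.le_add_right _ _)).setReg x (Expr.bits_eval_le hs (.const 0) rfl)
    obtain ⟨t, e, ht, hb⟩ := key (s.arr 0 c).toNat _ _ b₀ (by omega)
      (by simp [State.setReg]) (by simp [State.setReg]; omega)
    refine ⟨_, .seq (.assign x (.const 0) s) e, ?_, hb.mono (by omega)⟩
    have hKt : ((upto x c p).time L).eval S =
        (Expr.const 0).nodes * (L.eval S * L.eval S + 2 * L.eval S) + 1 + (S + 1) * K := by
      simp [time, hK, add_mul]
    rw [hKt]
    have : ((s.arr 0 c).toNat + 1) * K ≤ (S + 1) * K := Nat.mul_le_mul_right _ (by omega)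
    omega

end ForProg
end RAM

/-! ### The assignment problem: dual certificates -/

namespace Assignment

variable {n : ℕ} {C : Fin n → Fin n → ℤ} {u v : Fin n → ℤ}

/-- A perfect matching all of whose edges are tight for a feasible dual solution is optimal. -/
lemma sum_le_of_tight (hf : ∀ r j, u r + v j ≤ C r j) (A : Equiv.Perm (Fin n))
    (hA : ∀ r, u r + v (A r) = C r (A r)) (B : Equiv.Perm (Fin n)) :
    ∑ r, C r (A r) ≤ ∑ r, C r (B r) := by
  calc ∑ r, C r (A r) = ∑ r, u r + ∑ r, v (A r) := by
        rw [← Finset.sum_add_distrib]; exact Finset.sum_congr rfl fun r _ => (hA r).symm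
    _ = ∑ r, u r + ∑ r, v (B r) := by rw [Equiv.sum_comp A v, Equiv.sum_comp B v]
    _ = ∑ r, (u r + v (B r)) := by rw [Finset.sum_add_distrib]
    _ ≤ _ := Finset.sum_le_sum fun r _ => hf r (B r)

/-- State of the search for an augmenting path from row `k`, with the permutation `A` as current
assignment: column `j` has been reached if its rank is positive, namely through the tight edge
from row `par j`. -/
structure Search (C : Fin n → Fin n → ℤ) (u v : Fin n → ℤ) (k : Fin n) (A : Equiv.Perm (Fin n))
    (rank : Fin n → ℤ) (par : Fin n → Fin n) (t : ℕ) : Prop where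
  feasible : ∀ r j, u r + v j ≤ C r j
  tight : ∀ r < k, u r + v (A r) = C r (A r)
  rank_nonneg : ∀ j, 0 ≤ rank j
  rank_le : ∀ j, rank j ≤ t
  par_tight : ∀ j, 0 < rank j → u (par j) + v j = C (par j) j
  par_rank : ∀ j, 0 < rank j → par j = k ∨ 0 < rank (A (par j)) ∧ rank (A (par j)) < rank j
  progress : 0 < rank (A k) ∨ t ≤ (Finset.univ.filter fun j => 0 < rank j).card

/-- Covers the rounds left over once the goal column `A k` has been reached. -/
lemma Search.idle {k : Fin n} {A : Equiv.Perm (Fin n)} {rank : Fin n → ℤ} {par : Fin n → Fin n}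
    {t : ℕ} (h : Search C u v k A rank par t) (hk : 0 < rank (A k)) :
    Search C u v k A rank par (t + 1) :=
  { h with
    rank_le := fun j => (h.rank_le j).trans (by push_cast; omega)
    progress := Or.inl hk }

/-- Edges from a reached row to a reached column keep their slack, and so do the edges `(r, A r)`
with `r < k`, whose two ends are reached together. Only edges from reached rows to unreached columns
lose slack, namely δ, which is their minimum; so feasibility survives and `(r₀, j₀)` becomes tight.
The new rank `t + 1` exceeds all earlier ones. -/
lemma Search.step {k : Fin n} {A : Equiv.Perm (Fin n)} {rank : Fin n → ℤ} {par : Fin n → Fin n}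
    {t : ℕ} (h : Search C u v k A rank par t) (hk : ¬ 0 < rank (A k)) {r₀ j₀ : Fin n} {δ : ℤ}
    (hr₀ : r₀ = k ∨ 0 < rank (A r₀)) (hj₀ : ¬ 0 < rank j₀) (hδ : δ = C r₀ j₀ - u r₀ - v j₀)
    (hmin : ∀ r j, (r = k ∨ 0 < rank (A r)) → ¬ 0 < rank j → δ ≤ C r j - u r - v j)
    {u' v' rank' : Fin n → ℤ} {par' : Fin n → Fin n}
    (hu' : ∀ r, u' r = if r = k ∨ 0 < rank (A r) then u r + δ else u r)
    (hv' : ∀ j, v' j = if 0 < rank j then v j - δ else v j)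
    (hrank' : ∀ j, rank' j = if j = j₀ then (t : ℤ) + 1 else rank j)
    (hpar' : ∀ j, par' j = if j = j₀ then r₀ else par j) :
    Search C u' v' k A rank' par' (t + 1) := by
  have hδ0 : 0 ≤ δ := by have := h.feasible r₀ j₀; omega
  have hne : ∀ j, 0 < rank j → j ≠ j₀ := by rintro j hj rfl; exact hj₀ hj
  have hrk : ∀ j, 0 < rank j → rank' j = rank j := fun j hj => by rw [hrank', if_neg (hne j hj)]
  refine ⟨fun r j => ?_, fun r hr => ?_, fun j => ?_, fun j => ?_, fun j hj => ?_,
    fun j hj => ?_, ?_⟩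
  · have h1 := h.feasible r j
    have h2 := hmin r j
    rw [hu', hv']
    split_ifs with h3 h4
    · omega
    · have := h2 h3 h4; omega
    · omega
    · omega
  · have h1 := h.tight r hr
    rw [hu', hv']
    by_cases h3 : 0 < rank (A r)
    · simp only [h3, or_true, if_true]; omega
    · simp only [h3, hr.ne, or_self, if_false]; omega
  · have := h.rank_nonneg j
    rw [hrank']; split_ifs <;> omega
  · have := h.rank_le j
    rw [hrank']; push_cast; split_ifs <;> omega
  · rw [hpar', hu', hv']
    by_cases hj0 : j = j₀
    · subst hj0; simp only [if_true, hr₀, hj₀, if_false]; omega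
    · rw [hrank', if_neg hj0] at hj
      have h1 := h.par_tight j hj
      have h2 : par j = k ∨ 0 < rank (A (par j)) := (h.par_rank j hj).imp id And.left
      simp only [if_neg hj0, h2, hj, if_true]; omega
  · rw [hpar']
    by_cases hj0 : j = j₀
    · subst hj0
      simp only [if_true]
      refine hr₀.imp id fun h1 => ?_
      have h2 := h.rank_le (A r₀)
      rw [hrk _ h1, hrank', if_pos rfl]
      exact ⟨h1, by omega⟩
    · rw [hrank', if_neg hj0] at hj
      rw [if_neg hj0]
      refine (h.par_rank j hj).imp id fun h1 => ?_
      rw [hrk _ h1.1, hrk _ hj]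
      exact h1
  · right
    have h1 := h.progress.resolve_left hk
    have h2 : (Finset.univ.filter fun j => 0 < rank' j)
        = insert j₀ (Finset.univ.filter fun j => 0 < rank j) := by
      ext j
      simp only [Finset.mem_filter, Finset.mem_univ, true_and, Finset.mem_insert]
      rw [hrank']
      split_ifs with h3
      · simp only [h3, true_or, iff_true]; omega
      · simp [h3]
    rw [h2, Finset.card_insert_of_notMem (by simpa using hj₀)]
    omega

/-- Every round that does not idle reaches a new column, so after n rounds no column can be missing.
-/
lemma Search.reached {k : Fin n} {A : Equiv.Perm (Fin n)} {rank : Fin n → ℤ}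
    {par : Fin n → Fin n} (h : Search C u v k A rank par n) : 0 < rank (A k) := by
  rcases h.progress with h1 | h1
  · exact h1
  · have h2 : (Finset.univ.filter fun j => 0 < rank j) = Finset.univ :=
      Finset.eq_univ_of_card _ (le_antisymm (Finset.card_le_univ _) (by simpa using h1))
    have h3 := Finset.mem_univ (A k)
    rw [← h2] at h3
    exact (Finset.mem_filter.1 h3).2

/-- State of the augmentation, after `i` exchanges. -/
structure Augment (C : Fin n → Fin n → ℤ) (u v : Fin n → ℤ) (k : Fin n) (A : Equiv.Perm (Fin n))
    (rank : Fin n → ℤ) (par : Fin n → Fin n) (i : ℕ) : Prop where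
  tight : ∀ r < k, u r + v (A r) = C r (A r)
  par_tight : ∀ j, 0 < rank j → u (par j) + v j = C (par j) j
  par_rank : ∀ j, 0 < rank j → rank j ≤ rank (A k) →
    par j = k ∨ 0 < rank (A (par j)) ∧ rank (A (par j)) < rank j
  reached : 0 < rank (A k)
  progress : par (A k) = k ∨ rank (A k) + i ≤ n

lemma Search.augment {k : Fin n} {A : Equiv.Perm (Fin n)} {rank : Fin n → ℤ}
    {par : Fin n → Fin n} (h : Search C u v k A rank par n) :
    Augment C u v k A rank par 0 :=
  ⟨h.tight, h.par_tight, fun j hj _ => h.par_rank j hj, h.reached,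
    Or.inr (by simpa using h.rank_le (A k))⟩

/-- Row `p = par (A k)` takes over `A k` through a tight edge, and row `k` receives the old column
of `p`, which has smaller rank; the descent ends when `par (A k) = k`. From then on the swap is the
identity. -/
lemma Augment.step {k : Fin n} {A : Equiv.Perm (Fin n)} {rank : Fin n → ℤ} {par : Fin n → Fin n}
    {i : ℕ} (h : Augment C u v k A rank par i) :
    Augment C u v k (Equiv.swap k (par (A k)) |>.trans A) rank par (i + 1) := by
  set p := par (A k) with hp
  have hAk : (Equiv.swap k p |>.trans A) k = A p := by simp
  have hAp : (Equiv.swap k p |>.trans A) p = A k := by simp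
  have hA : ∀ r, r ≠ k → r ≠ p → (Equiv.swap k p |>.trans A) r = A r := fun r h1 h2 => by
    simp [Equiv.swap_apply_of_ne_of_ne h1 h2]
  by_cases hpk : p = k
  · have : (Equiv.swap k p |>.trans A) = A := by rw [hpk]; ext; simp
    rw [this]
    exact { h with progress := Or.inl (hp ▸ hpk) }
  · have hr := (h.par_rank (A k) h.reached le_rfl).resolve_left (hp ▸ hpk)
    rw [← hp] at hr
    refine ⟨fun r hrk => ?_, h.par_tight, fun j hj hj' => ?_, by rw [hAk]; exact hr.1, ?_⟩
    · by_cases hrp : r = p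
      · rw [hrp, hAp, hp]; exact h.par_tight _ h.reached
      · rw [hA r hrk.ne hrp]; exact h.tight r hrk
    · rw [hAk] at hj'
      have h1 := h.par_rank j hj (by omega)
      by_cases hjk : par j = k
      · exact Or.inl hjk
      · have h2 := h1.resolve_left hjk
        -- This is why `par_rank` is kept only for ranks up to that of `A k`: a column with
        -- predecessor `p` has larger rank than `A p`, the new column of `k`, so the change of `A`
        -- at `p` does no harm.
        have hjp : par j ≠ p := by intro e; rw [e] at h2; omega
        rw [hA _ hjk hjp]
        exact Or.inr h2
    · rw [hAk]
      right
      have := h.progress.resolve_left (hp ▸ hpk)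
      push_cast
      omega

/-- A positive rank cannot satisfy `rank (A k) + n ≤ n`, so `par (A k) = k` and the edge of row `k`
is tight as well. -/
lemma Augment.tight_succ {k : Fin n} {A : Equiv.Perm (Fin n)} {rank : Fin n → ℤ}
    {par : Fin n → Fin n} (h : Augment C u v k A rank par n) (r : Fin n) (hr : r ≤ k) :
    u r + v (A r) = C r (A r) := by
  rcases hr.lt_or_eq with h1 | rfl
  · exact h.tight r h1
  · have h2 := h.reached
    have h3 : par (A r) = r := h.progress.resolve_right (by omega)
    have := h.par_tight (A r) h2
    rwa [h3] at this

end Assignment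

namespace RAM

/-! ### The Hungarian method as a program -/

/-! ### Reading registers and cells after an update -/

@[simp] lemma State.reg_setReg (s : State) (x : ℕ) (v : ℤ) (y : ℕ) :
    (s.setReg x v).reg y = if y = x then v else s.reg y := by
  simp [State.setReg, Function.update_apply]

@[simp] lemma State.arr_setReg (s : State) (x : ℕ) (v : ℤ) : (s.setReg x v).arr = s.arr := rfl

@[simp] lemma State.reg_setArr (s : State) (a : ℕ) (z v : ℤ) : (s.setArr a z v).reg = s.reg := rfl

@[simp] lemma State.arr_setArr (s : State) (a : ℕ) (z v : ℤ) (b : ℕ) (w : ℤ) :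
    (s.setArr a z v).arr b w = if b = a ∧ w = z then v else s.arr b w := by
  by_cases h : b = a
  · subst h; simp [State.setArr, Function.update_apply]
  · simp [State.setArr, h]

namespace ForProg

@[simp] lemma run_skip (s : State) : skip.run s = s := rfl

@[simp] lemma run_assign (x : ℕ) (e : Expr) (s : State) :
    (assign x e).run s = s.setReg x (e.eval s) := rfl

@[simp] lemma run_store (a : ℕ) (i e : Expr) (s : State) :
    (store a i e).run s = s.setArr a (i.eval s) (e.eval s) := rfl

@[simp] lemma run_seq (p q : ForProg) (s : State) : (seq p q).run s = q.run (p.run s) := rfl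

@[simp] lemma run_ite (c : Expr) (p q : ForProg) (s : State) :
    (ite c p q).run s = if 0 < c.eval s then p.run s else q.run s := rfl

end ForProg

namespace Hungarian

open ForProg Assignment

/-! The arrays: `1` the assignment, `2` the costs, `3` and `4` the dual variables of rows and
columns, `5` the ranks of the columns, `6` their predecessors, `7` the mark of the current row.
The registers: `1` the current row, `2` the stage of the search. -/

/-- Cost of row `reg r` and column `reg j`. -/
def costE (r j : ℕ) : Expr := .get 2 (.add (.mul (.get 0 (.const 0)) (.reg r)) (.reg j))

/-- Reduced cost of row `reg r` and column `reg j`. -/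
def slackE (r j : ℕ) : Expr := .sub (.sub (costE r j) (.get 3 (.reg r))) (.get 4 (.reg j))

/-- Positive if row `reg 3` has been reached. -/
def reachedE : Expr := .add (.get 5 (.get 1 (.reg 3))) (.get 7 (.reg 3))

/-- The pair `(k, A k)` serves as initial candidate; it is admissible because the search runs only
while `A k` is unreached. -/
def findMin : ForProg :=
  .seq (.assign 6 (.reg 1)) <| .seq (.assign 7 (.get 1 (.reg 1))) <| .seq (.assign 5 (slackE 6 7)) <|
  .upto 3 0 <| .upto 4 0 <| .ite reachedE
    (.ite (.get 5 (.reg 4)) .skip <| .ite (.sub (.reg 5) (slackE 3 4))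
      (.seq (.assign 5 (slackE 3 4)) <| .seq (.assign 6 (.reg 3)) (.assign 7 (.reg 4))) .skip) .skip

def updateRows : ForProg :=
  .upto 3 0 <| .ite reachedE (.store 3 (.reg 3) (.add (.get 3 (.reg 3)) (.reg 5))) .skip

def updateCols : ForProg :=
  .upto 4 0 <| .ite (.get 5 (.reg 4)) (.store 4 (.reg 4) (.sub (.get 4 (.reg 4)) (.reg 5))) .skip

def reach : ForProg :=
  .seq (.store 6 (.reg 7) (.reg 6)) (.store 5 (.reg 7) (.add (.reg 2) (.const 1)))

/-- `reach` comes last: both dual updates must still see the old ranks. -/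
def searchStep : ForProg :=
  .ite (.get 5 (.get 1 (.reg 1))) .skip <|
    .seq findMin <| .seq updateRows <| .seq updateCols reach

def clear : ForProg :=
  .seq (.upto 4 0 <| .seq (.store 5 (.reg 4) (.const 0)) (.store 7 (.reg 4) (.const 0)))
    (.store 7 (.reg 1) (.const 1))

def exchange : ForProg :=
  .seq (.assign 8 (.get 1 (.reg 1))) <| .seq (.assign 9 (.get 6 (.reg 8))) <|
  .seq (.assign 10 (.get 1 (.reg 9))) <| .seq (.store 1 (.reg 9) (.reg 8))
    (.store 1 (.reg 1) (.reg 10))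

def phase : ForProg := .seq clear <| .seq (.upto 2 0 searchStep) (.upto 2 0 exchange)

/-- Takes v = 0 and u r = min(0, min_j C r j), which is feasible; no tight edge is needed before the
first phase. -/
def start : ForProg :=
  .upto 3 0 <| .seq (.store 1 (.reg 3) (.reg 3)) <| .seq (.store 4 (.reg 3) (.const 0)) <|
  .seq (.store 3 (.reg 3) (.const 0)) <|
  .upto 4 0 <| .ite (.sub (.get 3 (.reg 3)) (costE 3 4)) (.store 3 (.reg 3) (costE 3 4)) .skip

/-- The Hungarian method. -/
def program : ForProg := .seq start (.upto 1 0 phase)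

/-- Reduced cost in a state. -/
def slack (n : ℕ) (s : State) (r j : Fin n) : ℤ :=
  s.arr 2 (n * (r : ℕ) + (j : ℕ)) - s.arr 3 (r : ℕ) - s.arr 4 (j : ℕ)

/-- Positive if the row has been reached. -/
def reached {n : ℕ} (s : State) (r : Fin n) : ℤ := s.arr 5 (s.arr 1 (r : ℕ)) + s.arr 7 (r : ℕ)

/-! ### Specifications of the dual updates and of the minimum search -/

variable {n : ℕ}

lemma updateRows_spec {s : State} (hn : s.arr 0 0 = n) (r : Fin n) :
    (updateRows.run s).arr 3 (r : ℕ)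
      = if 0 < reached s r then s.arr 3 (r : ℕ) + s.reg 5 else s.arr 3 (r : ℕ) := by
  have := upto_induction (x := 3) (c := 0)
    (p := .ite reachedE (.store 3 (.reg 3) (.add (.get 3 (.reg 3)) (.reg 5))) .skip) hn rfl
    (fun i s' => ∀ r : Fin n, s'.arr 3 (r : ℕ) = if (r : ℕ) < i ∧ 0 < reached s r
      then s.arr 3 (r : ℕ) + s.reg 5 else s.arr 3 (r : ℕ))
    (by simp)
    (by
      intro i hi s' hx hr ha h r
      have h0 := h ⟨i, hi⟩
      simp only [lt_irrefl, false_and, if_false] at h0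
      have hre : reachedE.eval s' = reached s (⟨i, hi⟩ : Fin n) := by
        simp [reachedE, Expr.eval, reached, hx, ha 5 rfl, ha 1 rfl, ha 7 rfl]
      by_cases hri : (r : ℕ) = i
      · obtain rfl : r = ⟨i, hi⟩ := Fin.ext hri
        simp only [run_ite, hre]
        split_ifs with h1 h2 h2
        · simp [Expr.eval, hx, h0, hr 5 rfl]
        · exact absurd ⟨by simp, h1⟩ h2
        · exact absurd h2.2 h1
        · simpa using h0
      · have h1 : ((r : ℕ) < i + 1 ∧ 0 < reached s r) ↔ ((r : ℕ) < i ∧ 0 < reached s r) := by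
          have : (r : ℕ) < i + 1 ↔ (r : ℕ) < i := by omega
          rw [this]
        simp only [h1, ← h r, run_ite]
        split_ifs <;> simp [Expr.eval, hx, hri])
  simpa [updateRows] using this r

lemma updateCols_spec {s : State} (hn : s.arr 0 0 = n) (j : Fin n) :
    (updateCols.run s).arr 4 (j : ℕ)
      = if 0 < s.arr 5 (j : ℕ) then s.arr 4 (j : ℕ) - s.reg 5 else s.arr 4 (j : ℕ) := by
  have := upto_induction (x := 4) (c := 0)
    (p := .ite (.get 5 (.reg 4)) (.store 4 (.reg 4) (.sub (.get 4 (.reg 4)) (.reg 5))) .skip)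
    hn rfl
    (fun i s' => ∀ j : Fin n, s'.arr 4 (j : ℕ) = if (j : ℕ) < i ∧ 0 < s.arr 5 (j : ℕ)
      then s.arr 4 (j : ℕ) - s.reg 5 else s.arr 4 (j : ℕ))
    (by simp)
    (by
      intro i hi s' hx hr ha h j
      have h0 := h ⟨i, hi⟩
      simp only [lt_irrefl, false_and, if_false] at h0
      have hre : (Expr.get 5 (.reg 4)).eval s' = s.arr 5 i := by
        simp [Expr.eval, hx, ha 5 rfl]
      by_cases hji : (j : ℕ) = i
      · obtain rfl : j = ⟨i, hi⟩ := Fin.ext hji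
        simp only [run_ite, hre]
        split_ifs with h1 h2 h2
        · simp [Expr.eval, hx, h0, hr 5 rfl]
        · exact absurd ⟨by simp, h1⟩ h2
        · exact absurd h2.2 h1
        · simpa using h0
      · have h1 : ((j : ℕ) < i + 1 ∧ 0 < s.arr 5 (j : ℕ)) ↔ ((j : ℕ) < i ∧ 0 < s.arr 5 (j : ℕ)) := by
          have : (j : ℕ) < i + 1 ↔ (j : ℕ) < i := by omega
          rw [this]
        simp only [h1, ← h j, run_ite]
        split_ifs <;> simp [Expr.eval, hx, hji])
  simpa [updateCols] using this j

/-- The registers `5`, `6`, `7` hold the least reduced cost among the reached rows and the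
columns not reached with `Q r j`, its row, and its column. -/
def IsMinOn (s s' : State) (Q : Fin n → Fin n → Prop) : Prop :=
  ∃ r₀ j₀ : Fin n, s'.reg 6 = (r₀ : ℕ) ∧ s'.reg 7 = (j₀ : ℕ) ∧ s'.reg 5 = slack n s r₀ j₀ ∧
    0 < reached s r₀ ∧ ¬ 0 < s.arr 5 (j₀ : ℕ) ∧
    ∀ r j, Q r j → 0 < reached s r → ¬ 0 < s.arr 5 (j : ℕ) → s'.reg 5 ≤ slack n s r j

lemma IsMinOn.mono {s s' s'' : State} {Q Q' : Fin n → Fin n → Prop} (h : IsMinOn s s' Q)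
    (h5 : s''.reg 5 = s'.reg 5) (h6 : s''.reg 6 = s'.reg 6) (h7 : s''.reg 7 = s'.reg 7)
    (hQ : ∀ r j, Q' r j → Q r j) : IsMinOn s s'' Q' := by
  obtain ⟨r₀, j₀, e6, e7, e5, hr, hj, hm⟩ := h
  refine ⟨r₀, j₀, by rw [h6, e6], by rw [h7, e7], by rw [h5, e5], hr, hj, fun r j hq => ?_⟩
  rw [h5]
  exact hm r j (hQ r j hq)

lemma findMin_spec {s : State} (hn : s.arr 0 0 = n) {k h : Fin n} (hk : s.reg 1 = (k : ℕ))
    (hh : s.arr 1 (k : ℕ) = (h : ℕ)) (hmark : 0 < reached s k) (hrank : ¬ 0 < s.arr 5 (h : ℕ)) :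
    IsMinOn s (findMin.run s) fun _ _ : Fin n => True := by
  have key := upto_induction (x := 3) (c := 0) (N := n)
    (s := (assign 5 (slackE 6 7)).run <| (assign 7 (.get 1 (.reg 1))).run <|
      (assign 6 (.reg 1)).run s)
    (p := .upto 4 0 <| .ite reachedE
    (.ite (.get 5 (.reg 4)) .skip <| .ite (.sub (.reg 5) (slackE 3 4))
      (.seq (.assign 5 (slackE 3 4)) <| .seq (.assign 6 (.reg 3)) (.assign 7 (.reg 4))) .skip) .skip)
    hn rfl (fun i s' => IsMinOn s s' fun r _ : Fin n => (r : ℕ) < i)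
    ⟨k, h, by simp [Expr.eval, hk], by simp [Expr.eval, hk, hh],
      by simp [Expr.eval, slackE, costE, hk, hh, slack, hn], hmark, hrank, by simp⟩
    (by
      intro i hi s₁ hx hr ha hI
      have key := upto_induction (x := 4) (c := 0) (N := n) (s := s₁)
        (p := .ite reachedE
          (.ite (.get 5 (.reg 4)) .skip <| .ite (.sub (.reg 5) (slackE 3 4))
          (.seq (.assign 5 (slackE 3 4)) <| .seq (.assign 6 (.reg 3)) (.assign 7 (.reg 4))) .skip)
            .skip)
        (by rw [ha 0 rfl]; exact hn) rfl
        -- The pairs already examined are those lexicographically before `(i, l)`.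
        (fun l s' => IsMinOn s s' fun r j : Fin n => (r : ℕ) < i ∨ (r : ℕ) = i ∧ (j : ℕ) < l)
        (hI.mono rfl rfl rfl (by simp))
        (by
          intro l hl s₂ hx₂ hr₂ ha₂ hI₂
          have hA : ∀ a, s₂.arr a = s.arr a := by
            intro a
            rw [ha₂ a rfl, ha a rfl]
            simp
          have hx' : s₂.reg 3 = i := by rw [hr₂ 3 rfl, hx]
          have e1 : reachedE.eval s₂ = reached s (⟨i, hi⟩ : Fin n) := by
            simp [reachedE, Expr.eval, reached, hx', hA]
          have e2 : (Expr.get 5 (.reg 4)).eval s₂ = s.arr 5 l := by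
            simp [Expr.eval, hx₂, hA]
          have e3 : (slackE 3 4).eval s₂ = slack n s (⟨i, hi⟩ : Fin n) ⟨l, hl⟩ := by
            simp [slackE, costE, Expr.eval, hx₂, hx', hA, slack, hn]
          have e4 : (Expr.sub (.reg 5) (slackE 3 4)).eval s₂
              = s₂.reg 5 - slack n s (⟨i, hi⟩ : Fin n) ⟨l, hl⟩ := by rw [← e3]; rfl
          obtain ⟨r₀, j₀, f6, f7, f5, hr₀, hj₀, hm⟩ := hI₂
          have hcase : ∀ r j : Fin n, ((r : ℕ) < i ∨ (r : ℕ) = i ∧ (j : ℕ) < l + 1) →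
              ((r : ℕ) < i ∨ (r : ℕ) = i ∧ (j : ℕ) < l) ∨ (r = ⟨i, hi⟩ ∧ j = ⟨l, hl⟩) := by
            intro r j h
            simp only [Fin.ext_iff]
            omega
          simp only [run_ite, e1, e2, e4]
          split_ifs with c1 c2 c3
          · refine ⟨r₀, j₀, by simpa using f6, by simpa using f7, by simpa using f5, hr₀, hj₀,
              fun r j hq h1 h2 => ?_⟩
            rcases hcase r j hq with hq | ⟨rfl, rfl⟩
            · simpa using hm r j hq h1 h2
            · exact absurd c2 h2
          · refine ⟨⟨i, hi⟩, ⟨l, hl⟩, by simp [Expr.eval, hx'],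
              by simp [Expr.eval, hx₂], by simp [e3], c1, c2, fun r j hq h1 h2 => ?_⟩
            rcases hcase r j hq with hq | ⟨rfl, rfl⟩
            · have := hm r j hq h1 h2
              simp only [run_seq, run_assign, State.reg_setReg, e3]
              norm_num
              omega
            · simp [e3]
          · refine ⟨r₀, j₀, by simpa using f6, by simpa using f7, by simpa using f5, hr₀, hj₀,
              fun r j hq h1 h2 => ?_⟩
            rcases hcase r j hq with hq | ⟨rfl, rfl⟩
            · simpa using hm r j hq h1 h2
            · simp; omega
          · refine ⟨r₀, j₀, by simpa using f6, by simpa using f7, by simpa using f5, hr₀, hj₀,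
              fun r j hq h1 h2 => ?_⟩
            rcases hcase r j hq with hq | ⟨rfl, rfl⟩
            · simpa using hm r j hq h1 h2
            · exact absurd h1 c1)
      refine key.mono ?_ ?_ ?_ ?_
      · simp
      · simp
      · simp
      · intro r j h
        have := j.2
        omega)
  exact key.mono rfl rfl rfl fun r _ _ => r.2

end Hungarian
end RAM

/-! ### Correctness of the phases of the Hungarian method -/

namespace RAM.Hungarian

open ForProg Assignment

variable {n : ℕ} {C : Fin n → Fin n → ℤ}

/-- Array `2` holds the cost matrix. -/
def HasCosts (C : Fin n → Fin n → ℤ) (s : State) : Prop :=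
  ∀ r j : Fin n, s.arr 2 (n * (r : ℕ) + (j : ℕ)) = C r j

/-- Array `1` holds a permutation, arrays `3` and `4` a feasible dual solution that is tight on the
first `k` rows. -/
def IsPartial (C : Fin n → Fin n → ℤ) (k : ℕ) (s : State) : Prop :=
  ∃ A : Equiv.Perm (Fin n), (∀ r : Fin n, s.arr 1 (r : ℕ) = (A r : ℕ)) ∧
    (∀ r j : Fin n, s.arr 3 (r : ℕ) + s.arr 4 (j : ℕ) ≤ C r j) ∧
    ∀ r : Fin n, (r : ℕ) < k → s.arr 3 (r : ℕ) + s.arr 4 (A r : ℕ) = C r (A r)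

/-- The arrays hold a state of the search from row `k`. -/
def IsSearch (C : Fin n → Fin n → ℤ) (k : Fin n) (t : ℕ) (s : State) : Prop :=
  ∃ (A : Equiv.Perm (Fin n)) (par : Fin n → Fin n),
    (∀ r : Fin n, s.arr 1 (r : ℕ) = (A r : ℕ)) ∧
    (∀ j : Fin n, 0 < s.arr 5 (j : ℕ) → s.arr 6 (j : ℕ) = (par j : ℕ)) ∧
    (∀ r : Fin n, s.arr 7 (r : ℕ) = if r = k then 1 else 0) ∧
    Search C (fun r => s.arr 3 (r : ℕ)) (fun j => s.arr 4 (j : ℕ)) k A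
      (fun j => s.arr 5 (j : ℕ)) par t

lemma searchStep_spec {s : State} {k : Fin n} {t : ℕ} (hn : s.arr 0 0 = n) (hC : HasCosts C s)
    (hk : s.reg 1 = (k : ℕ)) (ht : s.reg 2 = t) (hs : IsSearch C k t s) :
    IsSearch C k (t + 1) (searchStep.run s) := by
  obtain ⟨A, par, hA, hpar, hmark, h⟩ := hs
  have hcond : (Expr.get 5 (.get 1 (.reg 1))).eval s = s.arr 5 (A k : ℕ) := by
    simp [Expr.eval, hk, hA]
  simp only [searchStep, run_ite, hcond]
  split_ifs with c
  · exact ⟨A, par, hA, hpar, hmark, h.idle c⟩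
  -- Rank and mark are nonnegative, so their sum is positive exactly when one of them is.
  · have hreach : ∀ r, 0 < reached s r ↔ (r = k ∨ 0 < s.arr 5 (A r : ℕ)) := by
      intro r
      have := h.rank_nonneg (A r)
      simp only [reached, hA, hmark]
      by_cases hrk : r = k
      · simp only [hrk, if_true, true_or, iff_true]; rw [← hrk]; omega
      · simp [hrk]
    obtain ⟨r₀, j₀, e6, e7, e5, hr₀, hj₀, hm⟩ :=
      findMin_spec hn hk (hA k) ((hreach k).2 (Or.inl rfl)) c
    simp only [run_seq]
    set s₁ := findMin.run s with hs₁
    have a₁ : ∀ a, s₁.arr a = s.arr a := fun a => run_arr findMin rfl s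
    have q₁ : s₁.reg 2 = s.reg 2 := run_reg findMin rfl s
    set s₂ := updateRows.run s₁ with hs₂
    have a₂ : ∀ a, a ≠ 3 → s₂.arr a = s.arr a := fun a ha => by
      rw [← a₁ a]; exact run_arr updateRows (by simp [updateRows, writesArr, ha.symm]) s₁
    have q₂ : ∀ x, x ≠ 3 → s₂.reg x = s₁.reg x := fun a ha =>
      run_reg updateRows (by simp [updateRows, writesReg, ha.symm]) s₁
    set s₃ := updateCols.run s₂ with hs₃
    have a₃ : ∀ a, a ≠ 4 → s₃.arr a = s₂.arr a := fun a ha =>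
      run_arr updateCols (by simp [updateCols, writesArr, ha.symm]) s₂
    have q₃ : ∀ x, x ≠ 4 → s₃.reg x = s₂.reg x := fun a ha =>
      run_reg updateCols (by simp [updateCols, writesReg, ha.symm]) s₂
    have r6 : s₃.reg 6 = (r₀ : ℕ) := by rw [q₃ 6 (by simp), q₂ 6 (by simp), e6]
    have r7 : s₃.reg 7 = (j₀ : ℕ) := by rw [q₃ 7 (by simp), q₂ 7 (by simp), e7]
    have r2 : s₃.reg 2 = t := by rw [q₃ 2 (by simp), q₂ 2 (by simp), q₁, ht]
    have hcast : ∀ i j : Fin n, (((i : ℕ) : ℤ) = ((j : ℕ) : ℤ)) ↔ i = j := fun i j => by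
      rw [Nat.cast_inj, Fin.ext_iff]
    have f1 : (reach.run s₃).arr 1 = s.arr 1 := by
      rw [run_arr reach rfl, a₃ 1 (by simp), a₂ 1 (by simp)]
    have f7 : (reach.run s₃).arr 7 = s.arr 7 := by
      rw [run_arr reach rfl, a₃ 7 (by simp), a₂ 7 (by simp)]
    have f3 : ∀ r : Fin n, (reach.run s₃).arr 3 (r : ℕ)
        = if r = k ∨ 0 < s.arr 5 (A r : ℕ) then s.arr 3 (r : ℕ) + s₁.reg 5
          else s.arr 3 (r : ℕ) := by
      intro r
      have hre : reached s₁ r = reached s r := by simp only [reached, a₁]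
      rw [run_arr reach rfl, a₃ 3 (by simp), hs₂, updateRows_spec (by rw [a₁]; exact hn), hre,
        a₁]
      simp only [hreach]
    have f4 : ∀ j : Fin n, (reach.run s₃).arr 4 (j : ℕ)
        = if 0 < s.arr 5 (j : ℕ) then s.arr 4 (j : ℕ) - s₁.reg 5 else s.arr 4 (j : ℕ) := by
      intro j
      rw [run_arr reach rfl, hs₃, updateCols_spec (by rw [a₂ 0 (by simp)]; exact hn),
        a₂ 5 (by simp), a₂ 4 (by simp), q₂ 5 (by simp)]
    have f5 : ∀ j : Fin n, (reach.run s₃).arr 5 (j : ℕ)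
        = if j = j₀ then (t : ℤ) + 1 else s.arr 5 (j : ℕ) := by
      intro j
      simp [reach, Expr.eval, r7, r2, a₃ 5, a₂ 5, hcast]
    have f6 : ∀ j : Fin n, (reach.run s₃).arr 6 (j : ℕ)
        = if j = j₀ then ((r₀ : ℕ) : ℤ) else s.arr 6 (j : ℕ) := by
      intro j
      simp [reach, Expr.eval, r7, r6, a₃ 6, a₂ 6, hcast]
    have hsl : ∀ r j, slack n s r j = C r j - s.arr 3 (r : ℕ) - s.arr 4 (j : ℕ) := fun r j => by
      rw [slack, hC]
    refine ⟨A, fun j => if j = j₀ then r₀ else par j, by rw [f1]; exact hA, fun j hj => ?_,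
      by rw [f7]; exact hmark, ?_⟩
    · rw [f5] at hj
      rw [f6]
      split_ifs at hj ⊢ with c1
      · simp [c1]
      · simpa [c1] using hpar j hj
    · refine h.step c ((hreach r₀).1 hr₀) hj₀ (e5.trans (hsl _ _)) (fun r j h1 h2 => ?_) f3 f4 f5
        (fun _ => rfl)
      have := hm r j trivial ((hreach r).2 h1) h2
      rwa [hsl] at this

lemma clear_spec {s : State} {k : Fin n} (hn : s.arr 0 0 = n) (hk : s.reg 1 = (k : ℕ))
    (hs : IsPartial C k s) : IsSearch C k 0 (clear.run s) := by
  have hcast : ∀ i j : Fin n, (((i : ℕ) : ℤ) = ((j : ℕ) : ℤ)) ↔ i = j := fun i j => by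
    rw [Nat.cast_inj, Fin.ext_iff]
  have key := upto_induction (x := 4) (c := 0) (s := s)
    (p := .seq (.store 5 (.reg 4) (.const 0)) (.store 7 (.reg 4) (.const 0))) hn rfl
    (fun i s' => ∀ j : Fin n, (j : ℕ) < i → s'.arr 5 (j : ℕ) = 0 ∧ s'.arr 7 (j : ℕ) = 0)
    (by simp)
    (by
      intro i hi s' hx hr ha h j hj
      by_cases hji : (j : ℕ) = i
      · simp [Expr.eval, hx, hji]
      · have := h j (by omega)
        simp [Expr.eval, hx, hji, this])
  obtain ⟨A, hA, hf, ht⟩ := hs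
  have f1 : (clear.run s).arr 1 = s.arr 1 := run_arr clear rfl s
  have f3 : (clear.run s).arr 3 = s.arr 3 := run_arr clear rfl s
  have f4 : (clear.run s).arr 4 = s.arr 4 := run_arr clear rfl s
  have f5 : ∀ j : Fin n, (clear.run s).arr 5 (j : ℕ) = 0 := by
    intro j
    simp [clear, Expr.eval, (key j j.2).1]
  have f7 : ∀ j : Fin n, (clear.run s).arr 7 (j : ℕ) = if j = k then 1 else 0 := by
    intro j
    simp [clear, Expr.eval, (key j j.2).2, run_reg, writesReg, hk, hcast]
  -- No column has positive rank yet, so any predecessor function will do.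
  refine ⟨A, id, by rw [f1]; exact hA, fun j hj => by simp [f5] at hj, f7, ?_⟩
  simp only [f3, f4, f5]
  exact ⟨hf, ht, by simp, by simp, by simp, by simp, by simp⟩

/-- The arrays hold a state of the augmentation. -/
def IsAugment (C : Fin n → Fin n → ℤ) (k : Fin n) (i : ℕ) (s : State) : Prop :=
  ∃ (A : Equiv.Perm (Fin n)) (par : Fin n → Fin n),
    (∀ r : Fin n, s.arr 1 (r : ℕ) = (A r : ℕ)) ∧
    (∀ j : Fin n, 0 < s.arr 5 (j : ℕ) → s.arr 6 (j : ℕ) = (par j : ℕ)) ∧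
    (∀ r j : Fin n, s.arr 3 (r : ℕ) + s.arr 4 (j : ℕ) ≤ C r j) ∧
    Augment C (fun r => s.arr 3 (r : ℕ)) (fun j => s.arr 4 (j : ℕ)) k A
      (fun j => s.arr 5 (j : ℕ)) par i

lemma exchange_spec {s : State} {k : Fin n} {i : ℕ} (hk : s.reg 1 = (k : ℕ))
    (hs : IsAugment C k i s) : IsAugment C k (i + 1) (exchange.run s) := by
  obtain ⟨A, par, hA, hpar, hf, h⟩ := hs
  have hcast : ∀ i j : Fin n, (((i : ℕ) : ℤ) = ((j : ℕ) : ℤ)) ↔ i = j := fun i j => by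
    rw [Nat.cast_inj, Fin.ext_iff]
  have ha : ∀ a, a ≠ 1 → (exchange.run s).arr a = s.arr a := fun a h =>
    run_arr exchange (by simp [exchange, writesArr, h.symm]) s
  have h1 : ∀ r : Fin n, (exchange.run s).arr 1 (r : ℕ)
      = ((Equiv.swap k (par (A k)) |>.trans A) r : ℕ) := by
    intro r
    have hp := hpar (A k) h.reached
    simp only [exchange, run_seq, run_assign, run_store, Expr.eval, State.reg_setReg,
      State.arr_setReg, State.reg_setArr, State.arr_setArr]
    norm_num [hk, hA, hp, hcast]
    by_cases c1 : r = k
    · simp [c1]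
    · by_cases c2 : r = par (A k)
      · simp only [c2, if_true, Equiv.swap_apply_right]
        -- If `par (A k) = k`, both writes hit cell `k`; the second one restores `A k`, which was
        -- read beforehand.
        split_ifs with e
        · rw [e]
        · rfl
      · simp [c1, c2, Equiv.swap_apply_of_ne_of_ne c1 c2]
  refine ⟨_, par, h1, ?_, ?_, ?_⟩
  · simpa only [ha 5 (by simp), ha 6 (by simp)] using hpar
  · simpa only [ha 3 (by simp), ha 4 (by simp)] using hf
  · simpa only [ha 3 (by simp), ha 4 (by simp), ha 5 (by simp)] using h.step

lemma phase_spec {s : State} {k : Fin n} (hn : s.arr 0 0 = n) (hC : HasCosts C s)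
    (hk : s.reg 1 = (k : ℕ)) (hs : IsPartial C k s) : IsPartial C (k + 1) (phase.run s) := by
  simp only [phase, run_seq]
  have h₀ := clear_spec hn hk hs
  set s₀ := clear.run s with hs₀
  have k₀ : s₀.reg 1 = (k : ℕ) := by rw [← hk]; exact run_reg clear rfl s
  have n₀ : s₀.arr 0 0 = n := by rw [← hn]; exact congrFun (run_arr clear rfl s) 0
  have c₀ : HasCosts C s₀ := fun r j => by
    rw [← hC]; exact congrFun (run_arr clear rfl s) _
  have h₁ := upto_induction (x := 2) (c := 0) (s := s₀) (p := searchStep) n₀ rfl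
    (fun t s' => IsSearch C k t s') h₀ (by
      intro t _ s' hx hr ha h
      exact searchStep_spec (by rw [ha 0 rfl, n₀]) (fun r j => by rw [ha 2 rfl, c₀])
        (by rw [hr 1 rfl, k₀]) hx h)
  set s₁ := (upto 2 0 searchStep).run s₀ with hs₁
  have k₁ : s₁.reg 1 = (k : ℕ) := by rw [← k₀]; exact run_reg (upto 2 0 searchStep) rfl s₀
  have n₁ : s₁.arr 0 0 = n := by
    rw [← n₀]; exact congrFun (run_arr (upto 2 0 searchStep) rfl s₀) 0
  have h₂ := upto_induction (x := 2) (c := 0) (s := s₁) (p := exchange) n₁ rfl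
    (fun t s' => IsAugment C k t s') (by
      obtain ⟨A, par, hA, hpar, -, h⟩ := h₁
      exact ⟨A, par, hA, hpar, h.feasible, h.augment⟩) (by
      intro t _ s' hx hr ha h
      exact exchange_spec (by rw [hr 1 rfl, k₁]) h)
  obtain ⟨A, par, hA, hpar, hf, h⟩ := h₂
  exact ⟨A, hA, hf, fun r hr => h.tight_succ r (Nat.lt_succ_iff.1 hr)⟩

lemma start_spec {s : State} (hn : s.arr 0 0 = n) (hC : HasCosts C s) :
    IsPartial C 0 (start.run s) := by
  have key := upto_induction (x := 3) (c := 0) (s := s)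
    (p := .seq (.store 1 (.reg 3) (.reg 3)) <| .seq (.store 4 (.reg 3) (.const 0)) <|
      .seq (.store 3 (.reg 3) (.const 0)) <| .upto 4 0 <|
        .ite (.sub (.get 3 (.reg 3)) (costE 3 4)) (.store 3 (.reg 3) (costE 3 4)) .skip) hn rfl
    (fun i s' => ∀ r : Fin n, (r : ℕ) < i → s'.arr 1 (r : ℕ) = (r : ℕ) ∧ s'.arr 4 (r : ℕ) = 0 ∧
      ∀ j : Fin n, s'.arr 3 (r : ℕ) ≤ C r j)
    (by simp)
    (by
      intro i hi s₀ hx hr ha hI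
      simp only [run_seq]
      set s₁ := (store 3 (.reg 3) (.const 0)).run ((store 4 (.reg 3) (.const 0)).run
        ((store 1 (.reg 3) (.reg 3)).run s₀)) with hs₁
      have x₁ : s₁.reg 3 = i := by simp [hs₁, hx]
      have b₁ : ∀ r : Fin n, (r : ℕ) < i + 1 → s₁.arr 1 (r : ℕ) = (r : ℕ) ∧ s₁.arr 4 (r : ℕ) = 0 := by
        intro r hri
        by_cases c : (r : ℕ) = i
        · simp [hs₁, Expr.eval, hx, c]
        · have := hI r (by omega)
          simp [hs₁, Expr.eval, hx, c, this]
      have b₃ : ∀ r : Fin n, (r : ℕ) < i → ∀ j, s₁.arr 3 (r : ℕ) ≤ C r j := by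
        intro r hri j
        have c : (r : ℕ) ≠ i := by omega
        simpa [hs₁, Expr.eval, hx, c] using (hI r hri).2.2 j
      have a₁ : s₁.arr 0 = s.arr 0 := by rw [← ha 0 rfl]; simp [hs₁, State.setArr]
      have a₂ : s₁.arr 2 = s.arr 2 := by rw [← ha 2 rfl]; simp [hs₁, State.setArr]
      have key := upto_induction (x := 4) (c := 0) (N := n) (s := s₁)
        (p := .ite (.sub (.get 3 (.reg 3)) (costE 3 4)) (.store 3 (.reg 3) (costE 3 4)) .skip)
        (by rw [a₁]; exact hn) rfl
        (fun l s' => ∀ r : Fin n, (r : ℕ) < i + 1 → ∀ j : Fin n, ((r : ℕ) < i ∨ (j : ℕ) < l) →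
          s'.arr 3 (r : ℕ) ≤ C r j)
        (by
          intro r _ j hrj
          exact b₃ r (by omega) j)
        (by
          intro l hl s₂ hx₂ hr₂ ha₂ hI₂ r hri j hrj
          have e1 : (costE 3 4).eval s₂ = C ⟨i, hi⟩ ⟨l, hl⟩ := by
            rw [← hC]
            simp [costE, Expr.eval, hx₂, hr₂ 3 rfl, x₁, ha₂ 0 rfl, ha₂ 2 rfl, a₁, a₂, hn]
          have e2 : (Expr.sub (.get 3 (.reg 3)) (costE 3 4)).eval s₂
              = s₂.arr 3 i - C ⟨i, hi⟩ ⟨l, hl⟩ := by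
            rw [← e1]
            simp [Expr.eval, hr₂ 3 rfl, x₁]
          have e3 : s₂.reg 3 = i := by rw [hr₂ 3 rfl, x₁]
          simp only [run_ite, e2]
          by_cases c : (r : ℕ) = i
          · obtain rfl : r = ⟨i, hi⟩ := Fin.ext c
            by_cases c' : (j : ℕ) = l
            · obtain rfl : j = ⟨l, hl⟩ := Fin.ext c'
              split_ifs with h0
              · simp [Expr.eval, e1, e3]
              · simp; simpa using h0
            · have h1 := hI₂ ⟨i, hi⟩ hri j (by omega)
              split_ifs with h0
              · simp [Expr.eval, e1, e3]; simp at h1; omega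
              · simpa using h1
          · have h1 := hI₂ r hri j (by omega)
            split_ifs with h0
            · simpa [Expr.eval, e3, c] using h1
            · simpa using h1)
      intro r hri
      have h1 := b₁ r hri
      have h3 : ∀ a, a ≠ 3 → (((upto 4 0 <|
        .ite (.sub (.get 3 (.reg 3)) (costE 3 4)) (.store 3 (.reg 3) (costE 3 4)) .skip).run
          s₁).setReg 3 (i + 1 : ℕ)).arr a = s₁.arr a := fun a ha => by
        rw [State.arr_setReg]
        exact run_arr _ (by simp [writesArr, ha.symm]) s₁
      rw [h3 1 (by simp), h3 4 (by simp)]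
      exact ⟨h1.1, h1.2, fun j => key r hri j (Or.inr j.2)⟩)
  refine ⟨Equiv.refl _, fun r => (key r r.2).1, fun r j => ?_, fun r hr => absurd hr (by simp)⟩
  have h1 := (key r r.2).2.2 j
  have h2 := (key j j.2).2.1
  rw [← add_zero (C r j)]
  exact add_le_add h1 h2.le

/-- The program leaves an optimal assignment in array `1`. -/
theorem program_spec {s : State} (hn : s.arr 0 0 = n) (hC : HasCosts C s) :
    ∃ A : Equiv.Perm (Fin n), (∀ r : Fin n, (program.run s).arr 1 (r : ℕ) = (A r : ℕ)) ∧
      ∀ B : Equiv.Perm (Fin n), ∑ r, C r (A r) ≤ ∑ r, C r (B r) := by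
  simp only [program, run_seq]
  have h₀ := start_spec hn hC
  set s₀ := start.run s with hs₀
  have n₀ : s₀.arr 0 0 = n := by rw [← hn]; exact congrFun (run_arr start rfl s) 0
  have c₀ : HasCosts C s₀ := fun r j => by
    rw [← hC]; exact congrFun (run_arr start rfl s) _
  have h := upto_induction (x := 1) (c := 0) (s := s₀) (p := phase) n₀ rfl
    (fun k s' => IsPartial C k s') h₀ (by
      intro k hk s' hx hr ha h
      exact phase_spec (k := ⟨k, hk⟩) (by rw [ha 0 rfl, n₀]) (fun r j => by rw [ha 2 rfl, c₀]) hx h)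
  obtain ⟨A, hA, hf, ht⟩ := h
  exact ⟨A, hA, sum_le_of_tight hf A fun r => ht r r.2⟩

end RAM.Hungarian

namespace RAM.CostMatrix

open ForProg

/-! ### Bringing the costs to a common denominator -/

/-- The entry of the cost matrix in row `reg 3` and column `reg x`. -/
def entryE (x : ℕ) : Expr := .add (.mul (.get 0 (.const 0)) (.reg 3)) (.reg x)

/-- Denominator of the value whose numerator is in cell `reg 8` of the input. -/
def denE : Expr := .get 0 (.add (.reg 8) (.const 1))

/-- Entry `reg 2` of the characteristic vector of bundle `reg 3`. -/
def memE : Expr := .get 0 (.add (.add (.const 3)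
  (.add (.mul (.get 0 (.const 1)) (.reg 3)) (.reg 3))) (.reg 2))

def scale : ForProg :=
  .upto 3 0 <| .upto 4 0 <| .store 2 (entryE 4) (.mul denE (.get 2 (entryE 4)))

def addItem : ForProg :=
  .upto 3 0 <| .store 2 (entryE 1) (.add (.get 2 (entryE 1)) (.mul memE (.reg 7)))

def locate : ForProg :=
  .seq (.assign 8 (.add (.mul (.get 0 (.const 1)) (.add (.mul (.get 0 (.const 0)) (.reg 1))
    (.get 0 (.const 2)))) (.reg 2)))
  (.assign 8 (.add (.add (.const 3) (.mul (.get 0 (.const 0)) (.add (.get 0 (.const 1)) (.const 1))))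
    (.add (.reg 8) (.reg 8))))

/-- Processing of item `reg 2` for agent `reg 1`. -/
def item : ForProg :=
  .seq locate <| .seq (.assign 7 (.mul (.get 0 (.reg 8)) (.reg 5))) <| .seq scale <|
    .seq addItem (.assign 5 (.mul denE (.reg 5)))

/-- Computation of the costs; the common denominator is in register `5`. -/
def program : ForProg := .seq (.assign 5 (.const 1)) <| .upto 1 0 <| .upto 2 1 item

/-! ### Correctness of the cost computation -/

variable {n m : ℕ}

/-- Row-major addresses do not collide, so a write changes one matrix entry only. -/
lemma entry_inj (k k' l l' : Fin n) :
    ((n : ℤ) * (k : ℕ) + (l : ℕ) = n * (k' : ℕ) + (l' : ℕ)) ↔ k = k' ∧ l = l' := by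
  constructor
  · intro h
    have h' : (n * (k : ℕ) + (l : ℕ)) = n * (k' : ℕ) + (l' : ℕ) := by exact_mod_cast h
    have : finProdFinEquiv (k, l) = finProdFinEquiv (k', l') := by
      apply Fin.ext
      simp only [finProdFinEquiv_apply_val]
      omega
    simpa using finProdFinEquiv.injective this
  · rintro ⟨rfl, rfl⟩; rfl

lemma scale_spec {s : State} (hn : s.arr 0 0 = n) (k l : Fin n) :
    (scale.run s).arr 2 (n * (k : ℕ) + (l : ℕ))
      = s.arr 0 (s.reg 8 + 1) * s.arr 2 (n * (k : ℕ) + (l : ℕ)) := by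
  have key := upto_induction (x := 3) (c := 0) (s := s)
    (p := .upto 4 0 <| .store 2 (entryE 4) (.mul denE (.get 2 (entryE 4)))) hn rfl
    (fun i s' => ∀ k l : Fin n, s'.arr 2 (n * (k : ℕ) + (l : ℕ)) =
      if (k : ℕ) < i then s.arr 0 (s.reg 8 + 1) * s.arr 2 (n * (k : ℕ) + (l : ℕ))
      else s.arr 2 (n * (k : ℕ) + (l : ℕ)))
    (by simp)
    (by
      intro i hi s₁ hx hr ha hI
      obtain ⟨i, rfl⟩ : ∃ i' : Fin n, (i' : ℕ) = i := ⟨⟨i, hi⟩, rfl⟩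
      have key := upto_induction (x := 4) (c := 0) (N := n) (s := s₁)
        (p := .store 2 (entryE 4) (.mul denE (.get 2 (entryE 4)))) (by rw [ha 0 rfl]; exact hn) rfl
        (fun q s' => ∀ k l : Fin n, s'.arr 2 (n * (k : ℕ) + (l : ℕ)) =
          if (k : ℕ) < i ∨ (k : ℕ) = i ∧ (l : ℕ) < q
          then s.arr 0 (s.reg 8 + 1) * s.arr 2 (n * (k : ℕ) + (l : ℕ))
          else s.arr 2 (n * (k : ℕ) + (l : ℕ)))
        (by simpa using hI)
        (by
          intro q hq s₂ hx₂ hr₂ ha₂ hI₂ k l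
          obtain ⟨q, rfl⟩ : ∃ q' : Fin n, (q' : ℕ) = q := ⟨⟨q, hq⟩, rfl⟩
          have e1 : (entryE 4).eval s₂
              = n * (i : ℕ) + (q : ℕ) := by
            simp [entryE, Expr.eval, hx₂, hr₂ 3 rfl, hx, ha₂ 0 rfl, ha 0 rfl, hn]
          have e2 : denE.eval s₂ = s.arr 0 (s.reg 8 + 1) := by
            simp [denE, Expr.eval, hr₂ 8 rfl, hr 8 rfl, ha₂ 0 rfl, ha 0 rfl]
          simp only [run_store, Expr.eval, e1, e2, State.arr_setReg, State.arr_setArr, true_and,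
            entry_inj]
          by_cases c : k = i ∧ l = q
          · have h1 := hI₂ i q
            rw [if_neg (by simp)] at h1
            rw [if_pos c, h1, if_pos (by rw [c.1, c.2]; simp), c.1, c.2]
          · rw [if_neg c, hI₂]
            refine if_congr ?_ rfl rfl
            simp only [Fin.ext_iff] at c
            omega)
      intro k l
      rw [State.arr_setReg, key]
      refine if_congr ?_ rfl rfl
      have := l.2
      omega)
  rw [scale, key, if_pos k.2]

lemma addItem_spec {s : State} (hn : s.arr 0 0 = n) (hm : s.arr 0 1 = m) {j : Fin n}
    (hj : s.reg 1 = (j : ℕ)) (k l : Fin n) :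
    (addItem.run s).arr 2 (n * (k : ℕ) + (l : ℕ))
      = s.arr 2 (n * (k : ℕ) + (l : ℕ)) +
        if l = j then s.arr 0 (3 + (m * (k : ℕ) + (k : ℕ)) + s.reg 2) * s.reg 7 else 0 := by
  have key := upto_induction (x := 3) (c := 0) (s := s)
    (p := .store 2 (entryE 1) (.add (.get 2 (entryE 1)) (.mul memE (.reg 7)))) hn rfl
    (fun i s' => ∀ k l : Fin n, s'.arr 2 (n * (k : ℕ) + (l : ℕ)) =
      s.arr 2 (n * (k : ℕ) + (l : ℕ)) + if (k : ℕ) < i ∧ l = j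
        then s.arr 0 (3 + (m * (k : ℕ) + (k : ℕ)) + s.reg 2) * s.reg 7 else 0)
    (by simp)
    (by
      intro i hi s₂ hx hr ha hI k l
      obtain ⟨i, rfl⟩ : ∃ i' : Fin n, (i' : ℕ) = i := ⟨⟨i, hi⟩, rfl⟩
      have e1 : (entryE 1).eval s₂ = n * (i : ℕ) + (j : ℕ) := by
        simp [entryE, Expr.eval, hx, hr 1 rfl, ha 0 rfl, hn, hj]
      have e2 : memE.eval s₂ = s.arr 0 (3 + (m * (i : ℕ)
          + (i : ℕ)) + s.reg 2) := by
        simp [memE, Expr.eval, hx, hr 2 rfl, ha 0 rfl, hm]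
      simp only [run_store, Expr.eval, e1, e2, hr 7 rfl, State.arr_setReg, State.arr_setArr,
        true_and, entry_inj]
      by_cases c : k = i ∧ l = j
      · have h1 := hI i j
        rw [if_neg (by simp), add_zero] at h1
        rw [if_pos c, h1, if_pos (by rw [c.1]; exact ⟨by simp, c.2⟩), c.1, c.2]
      · rw [if_neg c, hI]
        congr 1
        refine if_congr ?_ rfl rfl
        simp only [Fin.ext_iff] at c ⊢
        omega)
  rw [addItem, key]
  simp

/-- The input array holds the values of an instance: `a` is the agent, `chi k b` tells whether
item `b` is in bundle `k`, and `num j b / den j b` is the value of item `b` in the hands of `j`. -/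
structure HasInput (n m : ℕ) (a : ℕ) (chi num den : ℕ → ℕ → ℤ) (s : State) : Prop where
  agents : s.arr 0 0 = n
  items : s.arr 0 1 = m
  agent : s.arr 0 2 = a
  mem : ∀ k < n, ∀ b < m, s.arr 0 (3 + (m * k + k) + b) = chi k b
  num_eq : ∀ j < n, ∀ b < m, s.arr 0 (3 + n * (m + 1) +
    ((m * (n * j + a) + b) + (m * (n * j + a) + b))) = num j b
  den_eq : ∀ j < n, ∀ b < m, s.arr 0 (3 + n * (m + 1) +
    ((m * (n * j + a) + b) + (m * (n * j + a) + b)) + 1) = den j b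
  den_pos : ∀ j < n, ∀ b < m, 0 < den j b

lemma HasInput.congr {a : ℕ} {chi num den : ℕ → ℕ → ℤ} {s s' : State}
    (h : HasInput n m a chi num den s) (hs : s'.arr 0 = s.arr 0) :
    HasInput n m a chi num den s' :=
  ⟨by rw [hs]; exact h.agents, by rw [hs]; exact h.items, by rw [hs]; exact h.agent,
    by rw [hs]; exact h.mem, by rw [hs]; exact h.num_eq, by rw [hs]; exact h.den_eq, h.den_pos⟩

/-- With D in register 5 before the step, the new factor is den · D, and num/den scaled by it is num
· D: the summand is an integer without any division. -/
lemma item_spec {a : ℕ} {chi num den : ℕ → ℕ → ℤ} {s : State}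
    (hs : HasInput n m a chi num den s) {j b : ℕ} (hj : j < n) (hb : b < m)
    (h1 : s.reg 1 = j) (h2 : s.reg 2 = b) :
    (item.run s).reg 5 = den j b * s.reg 5 ∧
    ∀ k l : Fin n, (item.run s).arr 2 (n * (k : ℕ) + (l : ℕ)) =
      den j b * s.arr 2 (n * (k : ℕ) + (l : ℕ)) +
        if (l : ℕ) = j then chi k b * (num j b * s.reg 5) else 0 := by
  simp only [item, run_seq]
  set s₁ := (assign 7 (.mul (.get 0 (.reg 8)) (.reg 5))).run (locate.run s) with hs₁
  have a₁ : s₁.arr = s.arr := rfl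
  have r8 : s₁.reg 8 = 3 + n * (m + 1) + ((m * (n * j + a) + b) + (m * (n * j + a) + b)) := by
    simp [hs₁, locate, Expr.eval, h1, h2, hs.agents, hs.items, hs.agent]
  have r7 : s₁.reg 7 = num j b * s.reg 5 := by
    rw [← hs.num_eq j hj b hb]
    simp [hs₁, locate, Expr.eval, h1, h2, hs.agents, hs.items, hs.agent]
  have r1 : s₁.reg 1 = j := by simp [hs₁, locate, h1]
  have r2 : s₁.reg 2 = b := by simp [hs₁, locate, h2]
  have r5 : s₁.reg 5 = s.reg 5 := by simp [hs₁, locate]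
  have hden : s₁.arr 0 (s₁.reg 8 + 1) = den j b := by rw [a₁, r8, hs.den_eq j hj b hb]
  have hn₁ : s₁.arr 0 0 = n := hs.agents
  set s₂ := scale.run s₁ with hs₂
  have z₂ : s₂.arr 0 = s.arr 0 := run_arr scale rfl s₁
  set s₃ := addItem.run s₂ with hs₃
  have z₃ : s₃.arr 0 = s.arr 0 := (run_arr addItem rfl s₂).trans z₂
  constructor
  · have q8 : s₃.reg 8 = s₁.reg 8 := (run_reg addItem rfl s₂).trans (run_reg scale rfl s₁)
    have q5 : s₃.reg 5 = s₁.reg 5 := (run_reg addItem rfl s₂).trans (run_reg scale rfl s₁)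
    simp only [run_assign, State.reg_setReg, if_true, denE, Expr.eval, q8, q5, z₃]
    rw [← a₁, hden, r5]
  · intro k l
    have q1 : s₂.reg 1 = s₁.reg 1 := run_reg scale rfl s₁
    have q2 : s₂.reg 2 = s₁.reg 2 := run_reg scale rfl s₁
    have q7 : s₂.reg 7 = s₁.reg 7 := run_reg scale rfl s₁
    rw [run_assign, State.arr_setReg, hs₃,
      addItem_spec (j := ⟨j, hj⟩) (by rw [z₂]; exact hs.agents) (by rw [z₂]; exact hs.items)
        (by rw [q1, r1]), hs₂, scale_spec hn₁, hden, ← hs₂, z₂, q2, q7, r2, r7,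
        hs.mem k k.2 b hb, a₁]
    simp only [Fin.ext_iff]

/-- The cost matrix after the processing of the items below `b` for agent `j` and of all items for
the agents before. -/
def IsCost (n m : ℕ) (chi num den : ℕ → ℕ → ℤ) (j b : ℕ) (s : State) : Prop :=
  0 < s.reg 5 ∧ ∀ k l : Fin n, (s.arr 2 (n * (k : ℕ) + (l : ℕ)) : ℚ) =
    s.reg 5 * ∑ b' ∈ Finset.range m, if (l : ℕ) < j ∨ (l : ℕ) = j ∧ b' < b
      then (chi k b' : ℚ) * (num l b' / den l b') else 0

lemma isCost_item {a : ℕ} {chi num den : ℕ → ℕ → ℤ} {s : State}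
    (hs : HasInput n m a chi num den s) {j b : ℕ} (hj : j < n) (hb : b < m)
    (h1 : s.reg 1 = j) (h2 : s.reg 2 = b) (h : IsCost n m chi num den j b s) :
    IsCost n m chi num den j (b + 1) (item.run s) := by
  obtain ⟨h5, hA⟩ := item_spec hs hj hb h1 h2
  have hd := hs.den_pos j hj b hb
  refine ⟨by rw [h5]; exact mul_pos hd h.1, fun k l => ?_⟩
  rw [hA, h5]
  push_cast
  rw [h.2 k l]
  have key : (∑ b' ∈ Finset.range m, if (l : ℕ) < j ∨ (l : ℕ) = j ∧ b' < b + 1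
      then (chi k b' : ℚ) * (num l b' / den l b') else 0)
      = (∑ b' ∈ Finset.range m, if (l : ℕ) < j ∨ (l : ℕ) = j ∧ b' < b
      then (chi k b' : ℚ) * (num l b' / den l b') else 0)
      + if (l : ℕ) = j then (chi k b : ℚ) * (num l b / den l b) else 0 := by
    -- The new summand is written as a sum over all items, so that the two sums can be compared
    -- termwise.
    have : (if (l : ℕ) = j then (chi k b : ℚ) * (num l b / den l b) else 0)
        = ∑ b' ∈ Finset.range m, if b' = b then
          (if (l : ℕ) = j then (chi k b' : ℚ) * (num l b' / den l b') else 0) else 0 := by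
      rw [Finset.sum_ite_eq' (Finset.range m) b, if_pos (Finset.mem_range.2 hb)]
    rw [this, ← Finset.sum_add_distrib]
    refine Finset.sum_congr rfl fun b' _ => ?_
    by_cases c : b' = b
    · subst c
      by_cases c' : (l : ℕ) = j
      · simp [c']
      · simp [c']
    · have : b' < b + 1 ↔ b' < b := by omega
      simp [c, this]
  rw [key]
  by_cases c : (l : ℕ) = j
  · have hd' : (den j b : ℚ) ≠ 0 := by exact_mod_cast hd.ne'
    simp only [c, if_true]
    field_simp
  · simp only [c, if_false]
    ring

/-- The program computes the cost matrix, up to a positive factor. -/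
theorem program_spec {a : ℕ} {chi num den : ℕ → ℕ → ℤ} {s : State}
    (hs : HasInput n m a chi num den s) (h0 : ∀ z, s.arr 2 z = 0) :
    ∃ D : ℤ, 0 < D ∧ ∀ k l : Fin n, ((program.run s).arr 2 (n * (k : ℕ) + (l : ℕ)) : ℚ) =
      D * ∑ b ∈ Finset.range m, (chi k b : ℚ) * (num l b / den l b) := by
  have key := upto_induction (x := 1) (c := 0) (N := n) (s := (assign 5 (.const 1)).run s)
    (p := .upto 2 1 item) hs.agents rfl
    (fun j s' => IsCost n m chi num den j 0 s')
    ⟨by simp [Expr.eval], fun k l => by simp [h0]⟩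
    (by
      intro j hj s₁ hx hr ha hI
      have z₁ : s₁.arr 0 = s.arr 0 := ha 0 rfl
      have key := upto_induction (x := 2) (c := 1) (N := m) (s := s₁)
        (p := item) (by rw [z₁]; exact hs.items) rfl
        (fun b s' => IsCost n m chi num den j b s')
        ⟨by simpa using hI.1, by simpa using hI.2⟩
        (by
          intro b hb s₂ hx₂ hr₂ ha₂ hI₂
          have h := isCost_item (hs.congr ((ha₂ 0 rfl).trans z₁)) hj hb
            (by rw [hr₂ 1 rfl, hx]) hx₂ hI₂
          exact ⟨by simpa using h.1, by simpa using h.2⟩)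
      refine ⟨by simpa using key.1, fun k l => ?_⟩
      have h := key.2 k l
      have h5 : (((upto 2 1 item).run s₁).setReg 1 (j + 1 : ℕ)).reg 5
          = ((upto 2 1 item).run s₁).reg 5 := by simp
      rw [State.arr_setReg, h5, h]
      congr 1
      refine Finset.sum_congr rfl fun b hb => ?_
      congr 1
      -- Agent `j` with all m items done is the same stage as agent `j + 1` with none done.
      refine propext ?_
      have := Finset.mem_range.1 hb
      omega)
  refine ⟨_, key.1, fun k l => ?_⟩
  have h := key.2 k l
  simp only [l.2, true_or, if_true] at h
  exact h

end RAM.CostMatrix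

/-! ### The encoding of the input -/

/-- Blocks of equal length allow random access by address arithmetic; applied once per nesting level
of the encoding. -/
lemma List.getD_flatten_ofFn {α : Type*} {n L : ℕ} (f : Fin n → List α)
    (hL : ∀ k, (f k).length = L) (k : Fin n) {b : ℕ} (hb : b < L) (d : α) :
    (List.ofFn f).flatten.getD (L * k + b) d = (f k).getD b d := by
  induction n with
  | zero => exact k.elim0
  | succ n ih =>
    rw [List.ofFn_succ, List.flatten_cons]
    refine Fin.cases ?_ (fun k => ?_) k
    · rw [List.getD_append _ _ _ _ (by rw [hL]; simpa using hb)]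
      simp
    · rw [List.getD_append_right _ _ _ _ (by rw [hL, Fin.val_succ]; nlinarith), hL]
      rw [← ih (fun k => f k.succ) (fun k => hL _) k]
      congr 1
      rw [Fin.val_succ, mul_add]
      omega

lemma List.length_flatten_ofFn {α : Type*} {n L : ℕ} (f : Fin n → List α)
    (hL : ∀ k, (f k).length = L) : (List.ofFn f).flatten.length = n * L := by
  induction n with
  | zero => simp
  | succ n ih =>
    rw [List.ofFn_succ, List.flatten_cons, List.length_append, hL, ih _ fun k => hL _]
    ring

namespace Externalities

open RAM

variable {n m : ℕ} (V : Valuations n m) (P : Partition n m) (i : Fin n)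

lemma length_encode : (encode V P i).length = 3 + n * (m + 1) + n * (n * (m * 2)) := by
  rw [encode, List.length_append, List.length_append, List.length_flatten_ofFn (L := m + 1),
    List.length_flatten_ofFn (L := n * (m * 2))]
  · simp
  · intro j
    refine List.length_flatten_ofFn _ fun a => ?_
    exact List.length_flatten_ofFn _ fun b => rfl
  · intro k; simp

lemma getD_encode_bundle (k : Fin n) (b : Fin m) :
    (encode V P i).getD (3 + (m * k + k) + b) 0 = if b ∈ P.bundle k then 1 else 0 := by
  have hlen := List.length_flatten_ofFn (L := m + 1) (fun k : Fin n =>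
      (List.ofFn fun b : Fin m => if b ∈ P.bundle k then (1 : ℤ) else 0) ++ [-1]) (by simp)
  have hk : (m + 1) * (k : ℕ) + b < n * (m + 1) := by
    have := k.2
    have := b.2
    nlinarith
  rw [encode, List.getD_append, List.getD_append_right _ _ _ _ (by simp; omega)]
  · have h : 3 + (m * (k : ℕ) + k) + b - ([(n : ℤ), (m : ℤ), ((i : ℕ) : ℤ)] : List ℤ).length
        = (m + 1) * k + b := by simp [add_mul]; omega
    rw [h, List.getD_flatten_ofFn _ (by simp) k (by omega), List.getD_append _ _ _ _ (by simp)]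
    simp
  · rw [List.length_append, hlen]
    simp only [List.length_cons, List.length_nil]
    linarith

lemma getD_encode_value (j : Fin n) (b : Fin m) {c : ℕ} (hc : c < 2) :
    (encode V P i).getD (3 + n * (m + 1) + ((m * (n * j + i) + b) + (m * (n * j + i) + b)) + c) 0
      = ([(V.val j i {b}).num, ((V.val j i {b}).den : ℤ)] : List ℤ).getD c 0 := by
  have hlen : ([(n : ℤ), (m : ℤ), ((i : ℕ) : ℤ)] ++ (List.ofFn fun k : Fin n =>
      (List.ofFn fun b : Fin m => if b ∈ P.bundle k then (1 : ℤ) else 0) ++ [-1]).flatten).length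
      = 3 + n * (m + 1) := by
    rw [List.length_append, List.length_flatten_ofFn (L := m + 1) _ (by simp)]
    simp
  rw [encode, List.getD_append_right _ _ _ _ (by rw [hlen]; omega), hlen]
  have h3 : ∀ j a : Fin n, (List.ofFn fun b : Fin m =>
      [(V.val j a {b}).num, ((V.val j a {b}).den : ℤ)]).flatten.length = m * 2 := fun j a =>
    List.length_flatten_ofFn _ fun _ => rfl
  have hb : 2 * (b : ℕ) + c < m * 2 := by have := b.2; omega
  have hi : m * 2 * (i : ℕ) + (2 * b + c) < n * (m * 2) := by
    have := i.2
    nlinarith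
  have h : 3 + n * (m + 1) + ((m * (n * (j : ℕ) + i) + b) + (m * (n * j + i) + b)) + c
      - (3 + n * (m + 1)) = (n * (m * 2)) * j + (m * 2 * i + (2 * b + c)) := by
    rw [add_assoc, Nat.add_sub_cancel_left]
    ring
  rw [h, List.getD_flatten_ofFn _ (fun j => List.length_flatten_ofFn _ (h3 j)) j hi,
    List.getD_flatten_ofFn _ (h3 j) i hb,
    List.getD_flatten_ofFn (L := 2) _ (fun _ => rfl) b hc]

/-! ### Bounds for the initial state -/

lemma length_le_inputSize (l : List ℤ) : l.length ≤ inputSize l := by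
  rw [inputSize, ← List.length_map (f := bits)]
  exact List.length_le_sum_of_one_le _ (by simpa using fun z _ => one_le_bits z)

lemma bits_getD_le {l : List ℤ} (hl : l ≠ []) (k : ℕ) : bits (l.getD k 0) ≤ inputSize l := by
  by_cases hk : k < l.length
  · rw [List.getD_eq_getElem _ _ hk]
    exact List.single_le_sum (by simp) _ (List.mem_map_of_mem (List.getElem_mem hk))
  · rw [List.getD_eq_default _ _ (by omega)]
    have := length_le_inputSize l
    have := List.length_pos_iff.2 hl
    simp [bits]
    omega

lemma initial_arr_zero (l : List ℤ) (k : ℕ) : (initial l).arr 0 k = l.getD k 0 := by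
  simp [initial]

lemma encode_zero : (encode V P i).getD 0 0 = n := by simp [encode]
lemma encode_one : (encode V P i).getD 1 0 = m := by simp [encode]
lemma encode_two : (encode V P i).getD 2 0 = (i : ℕ) := by simp [encode]

/-- The bundles alone contribute n(m + 1) entries, end markers included, so the values n and m, not
just their lengths, are at most the size. The extra bit is for register 0, which holds the length of
the list. -/
lemma bounded_initial : Bounded (inputSize (encode V P i)) (inputSize (encode V P i) + 1)
    (initial (encode V P i)) := by
  have hne : encode V P i ≠ [] := by simp [encode]
  have hlen := length_le_inputSize (encode V P i)
  have hlen' := length_encode V P i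
  have hn : 0 < n := i.pos
  -- This uses n ≥ 1, which the existence of agent `i` provides.
  have hnm : n + m ≤ n * (m + 1) := by nlinarith
  have harr : ∀ a z, bits ((initial (encode V P i)).arr a z) ≤ inputSize (encode V P i) := by
    intro a z
    simp only [initial]
    split_ifs
    · exact bits_getD_le hne _
    · simp [bits]; omega
  refine ⟨fun x => ?_, fun a z => (harr a z).trans (Nat.le_succ _), harr 0, ?_, ?_⟩
  · simp only [initial]
    split_ifs
    · exact (bits_natCast_le _).trans (by omega)
    · simp [bits]
  · have := initial_arr_zero (encode V P i) 0
    rw [encode_zero] at this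
    rw [Nat.cast_zero] at this
    rw [this]
    simp; omega
  · have := initial_arr_zero (encode V P i) 1
    rw [encode_one] at this
    rw [Nat.cast_one] at this
    rw [this]
    simp; omega

/-! ### From the machine's cost matrix back to utilities -/

/-- Characteristic vectors of the bundles. -/
def chi (k b : ℕ) : ℤ :=
  if h : k < n ∧ b < m then if (⟨b, h.2⟩ : Fin m) ∈ P.bundle ⟨k, h.1⟩ then 1 else 0 else 0

/-- Value of an item for agent `i`, if allocated to agent `j`. -/
def value (j b : ℕ) : ℚ :=
  if h : j < n ∧ b < m then V.val ⟨j, h.1⟩ i {⟨b, h.2⟩} else 0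

lemma hasInput_initial : CostMatrix.HasInput n m i (chi P) (fun j b => (value V i j b).num)
    (fun j b => ((value V i j b).den : ℤ)) (initial (encode V P i)) := by
  refine ⟨?_, ?_, ?_, fun k hk b hb => ?_, fun j hj b hb => ?_, fun j hj b hb => ?_,
    fun j _ b _ => by exact_mod_cast (value V i j b).den_pos⟩
  · rw [← encode_zero V P i]; exact_mod_cast initial_arr_zero _ 0
  · rw [← encode_one V P i]; exact_mod_cast initial_arr_zero _ 1
  · rw [← encode_two V P i]; exact_mod_cast initial_arr_zero _ 2
  · have h := getD_encode_bundle V P i ⟨k, hk⟩ ⟨b, hb⟩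
    rw [← initial_arr_zero] at h
    push_cast at h
    rw [h, chi, dif_pos ⟨hk, hb⟩]
  · have h := getD_encode_value V P i ⟨j, hj⟩ ⟨b, hb⟩ (c := 0) (by omega)
    rw [← initial_arr_zero] at h
    push_cast at h
    rw [add_zero] at h
    rw [h, value, dif_pos ⟨hj, hb⟩]
    rfl
  · have h := getD_encode_value V P i ⟨j, hj⟩ ⟨b, hb⟩ (c := 1) (by omega)
    rw [← initial_arr_zero] at h
    push_cast at h
    rw [h, value, dif_pos ⟨hj, hb⟩]
    rfl

lemma utility_eq_sum (A : Allocation n) : utility V P i A =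
    ∑ k : Fin n, ∑ b ∈ Finset.range m, (chi P k b : ℚ) *
      ((value V i (A k) b).num / ((value V i (A k) b).den : ℤ)) := by
  refine Finset.sum_congr rfl fun k _ => ?_
  rw [V.additive, Finset.sum_range, ← Finset.sum_filter_add_sum_filter_not Finset.univ
    (· ∈ P.bundle k)]
  rw [Finset.sum_eq_zero (s := Finset.univ.filter fun b => ¬ b ∈ P.bundle k), add_zero,
    Finset.filter_univ_mem]
  · refine Finset.sum_congr rfl fun b hb => ?_
    rw [Int.cast_natCast, Rat.num_div_den]
    simp [chi, value, hb]
  · intro b hb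
    simp only [Finset.mem_filter, Finset.mem_univ, true_and] at hb
    simp [chi, hb]

/-- Computation of a worst allocation. -/
def worstAllocation : ForProg :=
  .seq CostMatrix.program <| .seq Hungarian.program (.assign 0 (.get 0 (.const 0)))

/-- The annotation `k : ℕ` places the coercion to ℤ inside the mapped function, so that output
entries can be read off by index. -/
lemma output_eq (s : State) :
    output s = (List.range (s.reg 0).toNat).map fun k : ℕ => s.arr 1 (k : ℤ) := by
  rw [output]
  generalize List.range (s.reg 0).toNat = l
  induction l with
  | nil => rfl
  | cons a l ih => simpa using ih

lemma output_worstAllocation : ∃ A : Allocation n, IsWorstAllocation V P i A ∧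
    output (worstAllocation.run (initial (encode V P i))) = encodeAllocation A := by
  set s := initial (encode V P i) with hs
  obtain ⟨D, hD, hcost⟩ := CostMatrix.program_spec (hasInput_initial V P i) fun z => by
    simp [initial]
  set s₁ := CostMatrix.program.run s with hs₁
  have z₁ : s₁.arr 0 = s.arr 0 := ForProg.run_arr CostMatrix.program rfl s
  have n₁ : s₁.arr 0 0 = n := by rw [z₁]; exact (hasInput_initial V P i).agents
  -- The cost matrix is taken to be whatever array 2 now contains.
  obtain ⟨A, hA, hopt⟩ := Hungarian.program_spec n₁ (fun r j => rfl)
  refine ⟨A, fun B => ?_, ?_⟩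
  · have hu : ∀ B : Allocation n, (D : ℚ) * utility V P i B
        = ((∑ k : Fin n, s₁.arr 2 (n * (k : ℕ) + (B k : ℕ)) : ℤ) : ℚ) := by
      intro B
      rw [utility_eq_sum, Finset.mul_sum, Int.cast_sum]
      exact Finset.sum_congr rfl fun k _ => (hcost k (B k)).symm
    have hD' : (0 : ℚ) < D := by exact_mod_cast hD
    refine le_of_mul_le_mul_left ?_ hD'
    rw [hu, hu]
    exact_mod_cast hopt B
  -- Register 0 initially holds the input length; the last assignment turns it into the output
  -- length n.
  · have hr : (worstAllocation.run s).reg 0 = n := by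
      simp only [worstAllocation, ForProg.run_seq, ForProg.run_assign, State.reg_setReg, if_true,
        Expr.eval]
      rw [ForProg.run_arr Hungarian.program rfl]
      exact n₁
    have ha : (worstAllocation.run s).arr 1 = (Hungarian.program.run s₁).arr 1 := rfl
    rw [output_eq, hr, Int.toNat_natCast]
    apply List.ext_getElem
    · simp [encodeAllocation]
    · intro k h1 h2
      simp only [encodeAllocation, List.length_ofFn] at h2
      simp only [encodeAllocation, List.getElem_map, List.getElem_range, List.getElem_ofFn,
        ha]
      exact hA ⟨k, h2⟩

end Externalities

/-- One program finds, on every instance of the general externalities model, a worst allocation of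
the given partition regarding the given agent, in time polynomial in the size of the input. -/
theorem lemma4 :
    ∃ (prog : RAM.Prog) (p : Polynomial ℕ),
      ∀ (n m : ℕ) (V : Externalities.Valuations n m) (P : Externalities.Partition n m)
        (i : Fin n),
        ∃ (s : RAM.State) (t : ℕ),
          RAM.Exec prog (RAM.initial (Externalities.encode V P i)) s t ∧
          t ≤ p.eval (RAM.inputSize (Externalities.encode V P i)) ∧
          ∃ A : Externalities.Allocation n,
            Externalities.IsWorstAllocation V P i A ∧
            RAM.output s = Externalities.encodeAllocation A := by
  -- The numbers start with at most S + 1 bits, S being the input size, and gain at most `growth`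
  -- bits; this is the length bound inserted into `time`.
  refine ⟨Externalities.worstAllocation.toProg, Externalities.worstAllocation.time
    (Polynomial.X + 1 + Externalities.worstAllocation.growth), fun n m V P i => ?_⟩
  obtain ⟨t, he, ht, -⟩ := Externalities.worstAllocation.exec_toProg rfl
    (Polynomial.X + 1 + Externalities.worstAllocation.growth) _ _ _
    (Externalities.bounded_initial V P i) (by simp)
  exact ⟨_, t, he, ht, Externalities.output_worstAllocation V P i⟩
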